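/- **Problem.** Let $d\ge 1$, let $\xi$ be a random variable with distribution $\Xi$, let $f(x)=\mathbb E_{\xi\sim\Xi}F(x;\xi)$ for $x\in\mathbb R^d$ (all these expectations being finite), and let $K=\operatorname{dom} f\subset\mathbb R^d$ be a non-empty compact convex set on which $f$ is minimized; $f^*=\min_{K}f$. Assume, with constants $L,\zeta,R,G$ and $\sigma=\sqrt d\,\zeta\ge 0$: * (smoothness) for almost every $\xi$ the loss $F(\cdot;\xi)$ is differentiable with $L$-Lipschitz gradient on $\mathbb R^d$ (hence so is $f$); * (variance) $\mathbb E[(\nabla F(x;\xi)-\nabla f(x))_i^2]\le\zeta^2$ for all $x\in K$ and $i=1,\dots,d$; * (convexity) $f(y)\ge f(x)+\langle\nabla f(x),y-x\rangle$ and $\|y-x\|\le R$ for all $x,y\in K$; * (bounded gradients) $\|\nabla f(x)\|\le G$ for all $x\in K$. **Algorithm (ZO-HGD).** Let $n_{\mathrm r}\ge1$, $\mu_{\mathrm r},\mu_{\mathrm c}>0$, $x_0\in K$. At step $t=0,\dots,T-1$ draw mini-batches $\mathcal B^{\mathrm r}_t,\mathcal B^{\mathrm c}_t$ of i.i.d.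 samples of $\xi$ (of arbitrary sizes $\ge1$) and, for every $\xi\in\mathcal B_t^{\mathrm r}$, directions $u_{1,\xi},\dots,u_{n_{\mathrm r},\xi}$ uniformly distributed on the unit sphere, all independent of each other and of the previous steps, and put $$\nabla_{\mathrm r,t}=\frac1{|\mathcal B^{\mathrm r}_t|}\sum_{\xi\in\mathcal B^{\mathrm r}_t}\frac1{n_{\mathrm r}}\sum_{i=1}^{n_{\mathrm r}}\frac{d\,[F(x_t+\mu_{\mathrm r}u_{i,\xi};\xi)-F(x_t;\xi)]}{\mu_{\mathrm r}}\,u_{i,\xi}.$$ Then compute probabilities $p_{t,i}$ from the past and from the data used in $\nabla_{\mathrm r,t}$, select a random set $\mathcal I_t\subseteq\{1,\dots,d\}$ with $\Pr(i\in\mathcal I_t)=p_{t,i}$ for each $i$, conditionally on the past, on the data used in $\nabla_{\mathrm r,t}$ and on $\mathcal B_t^{\mathrm c}$, and put, with the canonical basis vectors $e_i$, $$\nabla_{\mathrm c,t}=\frac1{|\mathcal B^{\mathrm c}_t|}\sum_{\xi\in\mathcal B^{\mathrm c}_t}\ \sum_{i\in\mathcal I_t}\frac1{p_{t,i}}\cdot\frac{F(x_t+\mu_{\mathrm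 c}e_i;\xi)-F(x_t-\mu_{\mathrm c}e_i;\xi)}{2\mu_{\mathrm c}}\,e_i,\qquad x_{t+1}=x_t-\eta_t\big(\alpha_t\nabla_{\mathrm r,t}+(1-\alpha_t)\nabla_{\mathrm c,t}\big).$$ **Theorem.** Suppose the assumptions above hold, that the iterates $x_0,\dots,x_T$ lie almost surely in $K$, and that $p_{t,i}\ge\bar c>0$ almost surely for all $i$ and all $t<T$. Put $d_{\mathrm{nr}}=1+d/n_{\mathrm r}$ and take $\alpha_t=\alpha=[1+\bar c\,d_{\mathrm{nr}}]^{-1}$ for all $t<T$. Let $$L\mu_{\mathrm c}\sqrt d\le\sigma\qquad\text{and}\qquad \mu_{\mathrm c}\le M\sqrt{\frac1{dT}\cdot\frac{d_{\mathrm{nr}}}{1+\bar c\,d_{\mathrm{nr}}}}$$ with a constant $M$. 1. (Convex.) Let $\mu_{\mathrm c}=\mu_{\mathrm r}\sqrt d/2$, and let the step size be the constant $\eta_t=\kappa\,\big(T\,d_{\mathrm{nr}}/(1+\bar c\,d_{\mathrm{nr}})\big)^{-1/2}$ for some $\kappa>0$. Then $$\frac1T\sum_{t=1}^T\mathbb E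 f(x_t)-f^*\le C\sqrt{\frac1T\cdot\frac{d_{\mathrm{nr}}}{1+\bar c\,d_{\mathrm{nr}}}},$$ where $C$ depends only on $L,R,G,\sigma,M,\kappa$. 2. (Strongly convex.) Suppose in addition that $f(y)\ge f(x)+\langle\nabla f(x),y-x\rangle+\frac{\bar\sigma}2\|y-x\|^2$ for all $x,y\in K$, with $\bar\sigma>0$. Let $\mu_{\mathrm r}=\mu_{\mathrm c}\sqrt{dL/\bar\sigma}$, $L\mu_{\mathrm r}d\le\sigma$, and $\eta_t=\frac8{\bar\sigma(a+t)}$ with $a>1$. With $w_t=(a+t)^2$, $S_T=\sum_{t=0}^{T-1}w_t$ and $\hat x_T=\frac1{S_T}\sum_{t=0}^{T-1}w_tx_t$, $$\mathbb E f(\hat x_T)-f^*\le C\cdot\frac1T\cdot\frac{d_{\mathrm{nr}}}{1+\bar c\,d_{\mathrm{nr}}},$$ where $C$ depends only on $L,R,G,\sigma,\bar\sigma,a,M$. All the expectations in 1 and 2 are of integrable random variables. -/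

import Mathlib

open MeasureTheory ProbabilityTheory

noncomputable section

namespace ZOHGD

/-- `ℝ^d` with the Euclidean norm. -/
abbrev Vec (d : ℕ) := EuclideanSpace ℝ (Fin d)

variable {d : ℕ} {Ξ : Type*}

/-! ### The stochastic optimisation problem and its assumptions -/

/-- The objective `f(x) = 𝔼_{ξ ∼ ν} F(x; ξ)`. -/
def objective [MeasurableSpace Ξ] (ν : Measure Ξ) (F : Vec d → Ξ → ℝ) : Vec d → ℝ :=
  fun x => ∫ ξ, F x ξ ∂ν

/-- The loss `F(·; ξ)` is measurable in all variables, has a finite expectation at every point,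
and (for almost every `ξ`) has an `L`-Lipschitz continuous gradient on `ℝ^d`.
It follows that the objective has an `L`-Lipschitz continuous gradient, too. -/
structure LipschitzGradient [MeasurableSpace Ξ] (ν : Measure Ξ) (F : Vec d → Ξ → ℝ) (L : ℝ) :
    Prop where
  measurable : Measurable (Function.uncurry F)
  integrable : ∀ x, Integrable (F x) ν
  differentiable : ∀ᵐ ξ ∂ν, Differentiable ℝ (fun x => F x ξ)
  lipschitz : ∀ᵐ ξ ∂ν, ∀ x y : Vec d,
    ‖gradient (fun z => F z ξ) x - gradient (fun z => F z ξ) y‖ ≤ L * ‖x - y‖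

/-- `𝔼[(∇F(x; ξ) - ∇f(x))_i ^ 2] ≤ ζ ^ 2` for all coordinates `i` and all `x` in the domain `K`. The
expectation is a Lebesgue integral in `[0, ∞]`, so that it is in particular finite. -/
def BoundedVariance [MeasurableSpace Ξ] (ν : Measure Ξ) (F : Vec d → Ξ → ℝ) (K : Set (Vec d))
    (ζ : ℝ) : Prop :=
  ∀ x ∈ K, ∀ i : Fin d,
    ∫⁻ ξ, ENNReal.ofReal ((gradient (fun z => F z ξ) x i - gradient (objective ν F) x i) ^ 2) ∂ν
      ≤ ENNReal.ofReal (ζ ^ 2)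

/-- `f` is convex on the compact convex domain `K`, whose diameter is at most `R`. -/
structure ConvexOnCompact (f : Vec d → ℝ) (K : Set (Vec d)) (R : ℝ) : Prop where
  isCompact : IsCompact K
  convex : Convex ℝ K
  le : ∀ x ∈ K, ∀ y ∈ K, f x + inner ℝ (gradient f x) (y - x) ≤ f y
  diam : ∀ x ∈ K, ∀ y ∈ K, ‖y - x‖ ≤ R

/-- `‖∇f(x)‖ ≤ G` on the domain `K`. -/
def BoundedGradient (f : Vec d → ℝ) (K : Set (Vec d)) (G : ℝ) : Prop :=
  ∀ x ∈ K, ‖gradient f x‖ ≤ G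

/-- `f` is strongly convex on the domain `K` with parameter `s`. -/
def StronglyConvexOnDomain (f : Vec d → ℝ) (K : Set (Vec d)) (s : ℝ) : Prop :=
  ∀ x ∈ K, ∀ y ∈ K, f x + inner ℝ (gradient f x) (y - x) + s / 2 * ‖y - x‖ ^ 2 ≤ f y

/-- The optimal value `f* = min_{x ∈ K} f(x)`. -/
def optValue (f : Vec d → ℝ) (K : Set (Vec d)) : ℝ := sInf (f '' K)

/-! ### The gradient estimators -/

/-- The uniform distribution on the unit sphere of `ℝ^d` (normalised surface measure), as a
measure on `ℝ^d`. -/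
def sphereUniform (d : ℕ) : Measure (Vec d) :=
  ((volume : Measure (Vec d)).toSphere Set.univ)⁻¹ •
    ((volume : Measure (Vec d)).toSphere.map Subtype.val)

/-- Average over a mini-batch. -/
def batchMean {b : ℕ} (g : Fin b → Vec d) : Vec d := (1 / (b : ℝ)) • ∑ j, g j

/-- The random gradient estimator (RGE) at a sample `ξ` along the directions `u_1, …, u_n`. -/
def rge (F : Vec d → Ξ → ℝ) (μr : ℝ) {n : ℕ} (u : Fin n → Vec d) (x : Vec d) (ξ : Ξ) : Vec d :=
  (1 / (n : ℝ)) • ∑ i, (((d : ℝ) * (F (x + μr • u i) ξ - F x ξ)) / μr) • u i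

/-- The `i`-th component of the coordinate-wise gradient estimator (CGE). -/
def cgeCoord (F : Vec d → Ξ → ℝ) (μc : ℝ) (i : Fin d) (x : Vec d) (ξ : Ξ) : Vec d :=
  ((F (x + μc • EuclideanSpace.single i (1 : ℝ)) ξ
      - F (x - μc • EuclideanSpace.single i (1 : ℝ)) ξ) / (2 * μc)) •
    EuclideanSpace.single i (1 : ℝ)

/-- The CGE over the coordinate set `I`, reweighted by the selection probabilities `p`. -/
def cge (F : Vec d → Ξ → ℝ) (μc : ℝ) (I : Finset (Fin d)) (p : Fin d → ℝ) (x : Vec d) (ξ : Ξ) :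
    Vec d :=
  ∑ i, ((if i ∈ I then (1 : ℝ) else 0) / p i) • cgeCoord F μc i x ξ

/-! ### The algorithm ZO-HGD -/

/-- The deterministic inputs of the algorithm. -/
structure Params where
  /-- number of random directions per stochastic sample -/
  nr : ℕ
  /-- size of the mini-batch used by RGE at step `t` -/
  br : ℕ → ℕ
  /-- size of the mini-batch used by CGE at step `t` -/
  bc : ℕ → ℕ
  /-- smoothing parameter of RGE -/
  μr : ℝ
  /-- smoothing parameter of CGE -/
  μc : ℝ
  /-- step sizes -/
  η : ℕ → ℝ
  /-- combination coefficients -/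
  α : ℕ → ℝ

/-- The random objects that occur in a run of the algorithm. -/
structure Trajectory (d : ℕ) (Ξ Ω : Type*) (prm : Params) where
  /-- mini-batch for RGE -/
  ξr : (t : ℕ) → Ω → Fin (prm.br t) → Ξ
  /-- random directions, `nr` for each sample in the mini-batch for RGE -/
  u : (t : ℕ) → Ω → Fin (prm.br t) → Fin prm.nr → Vec d
  /-- mini-batch for CGE -/
  ξc : (t : ℕ) → Ω → Fin (prm.bc t) → Ξ
  /-- coordinate selection probabilities -/
  p : ℕ → Ω → Fin d → ℝ
  /-- selected coordinates -/
  I : ℕ → Ω → Finset (Fin d)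
  /-- iterates -/
  x : ℕ → Ω → Vec d

namespace Trajectory

variable {Ω : Type*} {prm : Params} [MeasurableSpace Ξ]

/-- The `σ`-algebra generated by the mini-batch and the directions of RGE at step `t`. -/
abbrev rgeAlg (X : Trajectory d Ξ Ω prm) (t : ℕ) : MeasurableSpace Ω :=
  MeasurableSpace.comap (X.ξr t) inferInstance ⊔ MeasurableSpace.comap (X.u t) inferInstance

/-- The `σ`-algebra generated by the mini-batch of CGE at step `t`. -/
abbrev cgeAlg (X : Trajectory d Ξ Ω prm) (t : ℕ) : MeasurableSpace Ω :=
  MeasurableSpace.comap (X.ξc t) inferInstance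

/-- The `σ`-algebra generated by all the randomness of the steps `0, …, t - 1`. -/
abbrev past (X : Trajectory d Ξ Ω prm) (t : ℕ) : MeasurableSpace Ω :=
  ⨆ s ∈ Finset.range t, (X.rgeAlg s ⊔ X.cgeAlg s ⊔ MeasurableSpace.comap (X.I s) ⊤)

/-- The RGE `∇_{r,t}` of step `t`. -/
def gradR (X : Trajectory d Ξ Ω prm) (F : Vec d → Ξ → ℝ) (t : ℕ) (ω : Ω) : Vec d :=
  batchMean fun j => rge F prm.μr (X.u t ω j) (X.x t ω) (X.ξr t ω j)

/-- The CGE `∇_{c,t}` of step `t`. -/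
def gradC (X : Trajectory d Ξ Ω prm) (F : Vec d → Ξ → ℝ) (t : ℕ) (ω : Ω) : Vec d :=
  batchMean fun j => cge F prm.μc (X.I t ω) (X.p t ω) (X.x t ω) (X.ξc t ω j)

end Trajectory

/-- `X` is a run of `T` steps of ZO-HGD from the initial point `x₀`, on the probability space
`(Ω, P)`, for the loss `F` and samples with distribution `ν`. -/
structure IsRun {Ω : Type*} [MeasurableSpace Ω] (P : Measure Ω) [MeasurableSpace Ξ]
    (ν : Measure Ξ) (F : Vec d → Ξ → ℝ) (prm : Params) (x₀ : Vec d) (T : ℕ)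
    (X : Trajectory d Ξ Ω prm) : Prop where
  measurable_ξr : ∀ t < T, Measurable (X.ξr t)
  measurable_u : ∀ t < T, Measurable (X.u t)
  measurable_ξc : ∀ t < T, Measurable (X.ξc t)
  measurable_I : ∀ t < T, Measurable[_, ⊤] (X.I t)
  /-- The samples of both mini-batches of step `t` are drawn from `ν`, the directions are drawn
  uniformly from the unit sphere, and all of these are independent of each other … -/
  law : ∀ t < T,
    P.map (fun ω => (X.ξr t ω, X.u t ω, X.ξc t ω)) =
      (Measure.pi fun _ => ν).prod
        ((Measure.pi fun _ => Measure.pi fun _ => sphereUniform d).prod (Measure.pi fun _ => ν))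
  /-- … and of everything that happened in the earlier steps. -/
  indep : ∀ t < T, Indep (X.past t) (X.rgeAlg t ⊔ X.cgeAlg t) P
  /-- The selection probabilities are computed from the past and from the RGE of step `t`. -/
  measurable_p : ∀ t < T, Measurable[X.past t ⊔ X.rgeAlg t] (X.p t)
  /-- Given the past, the RGE and the mini-batch of CGE, the coordinate `i` is selected with
  probability `p_{t,i}`; no further condition is put on the joint law of the selection. -/
  select : ∀ t < T, ∀ i : Fin d,
    P[Set.indicator {ω | i ∈ X.I t ω} (fun _ => (1 : ℝ)) | X.past t ⊔ X.rgeAlg t ⊔ X.cgeAlg t]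
      =ᵐ[P] fun ω => X.p t ω i
  init : ∀ ω, X.x 0 ω = x₀
  step : ∀ t < T, ∀ ω, X.x (t + 1) ω =
    X.x t ω - prm.η t • (prm.α t • X.gradR F t ω + (1 - prm.α t) • X.gradC F t ω)

/-- The standing assumptions that both parts of the result share: the assumptions on the problem
(with `σ ^ 2 = d ζ ^ 2`), the run of the algorithm, whose iterates lie in the domain `K` of `f`, the
lower bound `c` on the selection probabilities, and the upper bound on the smoothing parameters. -/
structure Setting {Ω : Type*} [MeasurableSpace Ω] (P : Measure Ω) [MeasurableSpace Ξ]
    (ν : Measure Ξ) (F : Vec d → Ξ → ℝ) (K : Set (Vec d)) (L R G σ c : ℝ) (prm : Params) (T : ℕ)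
    (X : Trajectory d Ξ Ω prm) : Prop where
  d_pos : 1 ≤ d
  T_pos : 1 ≤ T
  nr_pos : 1 ≤ prm.nr
  br_pos : ∀ t < T, 1 ≤ prm.br t
  bc_pos : ∀ t < T, 1 ≤ prm.bc t
  μr_pos : 0 < prm.μr
  μc_pos : 0 < prm.μc
  smooth : LipschitzGradient ν F L
  variance : ∃ ζ : ℝ, (d : ℝ) * ζ ^ 2 = σ ^ 2 ∧ BoundedVariance ν F K ζ
  convex : ConvexOnCompact (objective ν F) K R
  boundedGradient : BoundedGradient (objective ν F) K G
  run : ∃ x₀ ∈ K, IsRun P ν F prm x₀ T X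
  mem_domain : ∀ t ≤ T, ∀ᵐ ω ∂P, X.x t ω ∈ K
  c_pos : 0 < c
  c_le : ∀ t < T, ∀ᵐ ω ∂P, ∀ i, c ≤ X.p t ω i
  μc_le : L * prm.μc * √(d : ℝ) ≤ σ

/-- `d_nr = 1 + d / n_r`. -/
def dnr (d nr : ℕ) : ℝ := 1 + (d : ℝ) / (nr : ℝ)

/-- The quantity `d_nr / (1 + c d_nr)`. -/
def effDim (d nr : ℕ) (c : ℝ) : ℝ := dnr d nr / (1 + c * dnr d nr)

/-- The weighted average of `x_0, …, x_{T-1}` with weights `w_t = (a + t) ^ 2`. -/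
def weightedAverage {Ω : Type*} {prm : Params} (X : Trajectory d Ξ Ω prm) (a : ℝ) (T : ℕ) (ω : Ω) :
    Vec d :=
  (1 / ∑ t ∈ Finset.range T, (a + (t : ℝ)) ^ 2) •
    ∑ t ∈ Finset.range T, (a + (t : ℝ)) ^ 2 • X.x t ω

end ZOHGD

end

open ZOHGD

/-!
The distance of the iterates to a minimiser `y ∈ K` satisfies the usual recursion of stochastic
gradient descent, and all that matters about the two estimators is their bias and their second
moment, both conditionally on the past.

* *Bias.* Both estimators are unbiased up to an error that comes from the smoothing. For the
  coordinate-wise estimator it is at most `L μ_c √d`, because the weights `1 / p_{t,i}` cancel the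
  selection probabilities (`Setting.integral_select_div`). For the random estimator it is at most
  `L μ_r`, with no factor depending on the dimension
  (`LSmooth.abs_integral_inner_rgeDir_sub_le`): the uniform distribution on the sphere is invariant
  under the reflection `ρ` along a given direction `v`, so that `⟨∇_r, v⟩` may be averaged over
  `u` and `ρ u`, and the increment of the loss between these two points is an increment along `v` of
  length proportional to `⟨u, v⟩`. This replaces the smoothed function `f_μ` and the divergence
  theorem.
* *Second moments.* With `n_r` independent directions for each sample, the second moment of the
  random estimator is of order `1 + d / n_r = d_nr` (`LSmooth.integral_norm_rge_sq_le`), and that of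
  the coordinate-wise one is of order `1 / c` (`Setting.integral_norm_cge_sq_le`). By convexity of
  the squared norm, no independence within a mini-batch is needed.

The estimates are proved for a fixed point of `K` and carried over to the iterate `x_t`, which is
independent of the samples of step `t` (`le_integral_of_indepFun`, `integral_le_of_indepFun`). With
`α = 1 / (1 + c d_nr)` the second moment of the search direction is a multiple of
`D = d_nr / (1 + c d_nr)`, and the result is the inequality for one step
`Setting.integral_norm_sub_sq_succ_le`.

In the convex case it is summed over `t`; since `D ≥ 1 / 2`, terms of order `1 / T` are
absorbed by the rate `√(D / T)`. In the strongly convex case half of the strong convexity pays for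
the bias, the rest makes the weighted recursion telescope (`sum_sq_mul_le_of_step`), and the
gradient inequality at the weighted average plays the role of Jensen's inequality.
-/

noncomputable section

namespace ZOHGD

variable {d : ℕ}

/-! ### Functions with a Lipschitz gradient -/

/-- `g` is differentiable on `ℝ^d` and its gradient is `L`-Lipschitz. -/
def LSmooth (L : ℝ) (g : Vec d → ℝ) : Prop :=
  Differentiable ℝ g ∧ ∀ x y : Vec d, ‖gradient g x - gradient g y‖ ≤ L * ‖x - y‖

theorem LSmooth.continuous {L : ℝ} {g : Vec d → ℝ} (hg : LSmooth L g) : Continuous g :=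
  hg.1.continuous

/-- A first-order expansion at `x` controls the increment between any two points near `x`. -/
theorem LSmooth.abs_sub_sub_inner_le {L : ℝ} (hL : 0 ≤ L) {g : Vec d → ℝ} (hg : LSmooth L g)
    {x y z : Vec d} {r : ℝ} (hy : ‖y - x‖ ≤ r) (hz : ‖z - x‖ ≤ r) :
    |g y - g z - inner ℝ (gradient g x) (y - z)| ≤ L * r * ‖y - z‖ := by
  have h := (convex_closedBall x r).norm_image_sub_le_of_norm_hasFDerivWithin_le'
    (f := g) (f' := fun w => InnerProductSpace.toDual ℝ (Vec d) (gradient g w))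
    (φ := InnerProductSpace.toDual ℝ (Vec d) (gradient g x)) (C := L * r) (x := z) (y := y)
    (fun w _ => (hg.1 w).hasGradientAt.hasFDerivAt.hasFDerivWithinAt)
    (fun w hw => by
      rw [← map_sub, LinearIsometryEquiv.norm_map]
      refine (hg.2 w x).trans (mul_le_mul_of_nonneg_left ?_ hL)
      simpa [dist_eq_norm] using hw)
    (by simpa [dist_eq_norm] using hz) (by simpa [dist_eq_norm] using hy)
  simpa [Real.norm_eq_abs] using h

theorem LSmooth.abs_add_sub_inner_le {L : ℝ} (hL : 0 ≤ L) {g : Vec d → ℝ} (hg : LSmooth L g)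
    (x v : Vec d) : |g (x + v) - g x - inner ℝ (gradient g x) v| ≤ L * ‖v‖ ^ 2 := by
  have h := hg.abs_sub_sub_inner_le hL (x := x) (y := x + v) (z := x) (r := ‖v‖) (by simp) (by simp)
  simpa [mul_assoc, pow_two] using h

theorem inner_single_one (w : Vec d) (i : Fin d) :
    inner ℝ w (EuclideanSpace.single i (1 : ℝ)) = w i := by
  simp [EuclideanSpace.inner_single_right]

theorem inner_eq_sum_mul (v w : Vec d) : inner ℝ v w = ∑ i, v i * w i := by
  simp [PiLp.inner_apply, mul_comm]

/-! ### The uniform distribution on the sphere -/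

theorem isProbabilityMeasure_sphereUniform (hd : 1 ≤ d) :
    IsProbabilityMeasure (sphereUniform d) := by
  have : NeZero d := ⟨by omega⟩
  constructor
  rw [sphereUniform, Measure.smul_apply, Measure.map_apply measurable_subtype_coe .univ,
    Set.preimage_univ, smul_eq_mul]
  refine ENNReal.inv_mul_cancel ?_ (measure_ne_top _ _)
  rw [Ne, Measure.measure_univ_eq_zero]
  exact Measure.toSphere_ne_zero _

theorem ae_norm_eq_one_sphereUniform : ∀ᵐ u ∂(sphereUniform d), ‖u‖ = 1 := by
  refine Measure.ae_smul_measure ?_ _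
  rw [ae_map_iff measurable_subtype_coe.aemeasurable
    (measurableSet_eq_fun (by fun_prop) (by fun_prop))]
  exact Filter.Eventually.of_forall fun u => by simp

open scoped Pointwise in
/-- The uniform distribution on the sphere is invariant under linear isometries, because the volume
of the cone over a subset of the sphere is. -/
theorem measurePreserving_sphereUniform (e : Vec d ≃ₗᵢ[ℝ] Vec d) :
    MeasurePreserving e (sphereUniform d) (sphereUniform d) := by
  refine ⟨e.continuous.measurable, ?_⟩
  rw [sphereUniform, Measure.map_smul]
  congr 1
  ext s hs
  have he : Measurable e := e.continuous.measurable
  rw [Measure.map_apply he hs, Measure.map_apply measurable_subtype_coe (he hs),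
    Measure.map_apply measurable_subtype_coe hs,
    Measure.toSphere_apply' _ (measurable_subtype_coe (he hs)),
    Measure.toSphere_apply' _ (measurable_subtype_coe hs),
    Subtype.image_preimage_coe, Subtype.image_preimage_coe]
  congr 1
  rw [← (e.measurePreserving).measure_preimage_emb e.toHomeomorph.measurableEmbedding
    (Set.Ioo (0 : ℝ) 1 • (Metric.sphere (0 : Vec d) 1 ∩ s))]
  congr 1
  ext w
  simp only [Set.mem_smul, Set.mem_inter_iff, Set.mem_preimage, mem_sphere_zero_iff_norm]
  constructor
  · rintro ⟨r, hr, u, ⟨hu, hus⟩, rfl⟩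
    exact ⟨r, hr, e u, ⟨by simpa using hu, hus⟩, by simp⟩
  · rintro ⟨r, hr, u, ⟨hu, hus⟩, h⟩
    refine ⟨r, hr, e.symm u, ⟨by simpa using hu, by simpa using hus⟩, ?_⟩
    apply e.injective
    simpa using h

theorem integrable_sphereUniform (hd : 1 ≤ d) {h : Vec d → ℝ} (hh : Measurable h) {C : ℝ}
    (hC : ∀ u, ‖u‖ = 1 → |h u| ≤ C) : Integrable h (sphereUniform d) := by
  have := isProbabilityMeasure_sphereUniform hd
  refine Integrable.of_bound hh.aestronglyMeasurable C ?_
  filter_upwards [ae_norm_eq_one_sphereUniform] with u hu using hC u hu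

theorem integrable_inner_sq_sphereUniform (hd : 1 ≤ d) (v : Vec d) :
    Integrable (fun u => inner ℝ v u ^ 2) (sphereUniform d) := by
  refine integrable_sphereUniform hd (by fun_prop) (C := ‖v‖ ^ 2) fun u hu => ?_
  rw [abs_pow]
  gcongr
  simpa [hu] using abs_real_inner_le_norm v u

/-- The uniform distribution on the sphere is isotropic: its second moments are those of
`d⁻¹ • 1`. Any two vectors of the same norm are exchanged by a reflection. -/
theorem integral_inner_sq_sphereUniform (hd : 1 ≤ d) (v : Vec d) :
    ∫ u, inner ℝ v u ^ 2 ∂(sphereUniform d) = ‖v‖ ^ 2 / d := by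
  have := isProbabilityMeasure_sphereUniform hd
  have key : ∀ i : Fin d, ∫ u, inner ℝ v u ^ 2 ∂(sphereUniform d)
      = ∫ u, ‖v‖ ^ 2 * (u i) ^ 2 ∂(sphereUniform d) := by
    intro i
    set w : Vec d := ‖v‖ • EuclideanSpace.single i (1 : ℝ)
    have hw : ‖v‖ = ‖w‖ := by simp [w, norm_smul]
    set ρ := (Submodule.span ℝ {v - w})ᗮ.reflection
    have hρ : ρ v = w := Submodule.reflection_sub hw
    rw [← (measurePreserving_sphereUniform ρ).integral_comp
      ρ.toHomeomorph.measurableEmbedding (fun u => ‖v‖ ^ 2 * (u i) ^ 2)]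
    congr 1 with u
    rw [← ρ.inner_map_map v u, hρ, inner_smul_left, EuclideanSpace.inner_single_left]
    simp [mul_pow]
  have hsum : ∑ i : Fin d, ∫ u, ‖v‖ ^ 2 * (u i) ^ 2 ∂(sphereUniform d) = ‖v‖ ^ 2 := by
    rw [← integral_finsetSum]
    · calc _ = ∫ u : Vec d, ‖v‖ ^ 2 ∂(sphereUniform d) := by
            refine integral_congr_ae ?_
            filter_upwards [ae_norm_eq_one_sphereUniform] with u hu
            rw [← Finset.mul_sum, ← EuclideanSpace.real_norm_sq_eq, hu]
            simp
        _ = _ := by simp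
    · intro i _
      have := integrable_inner_sq_sphereUniform hd (EuclideanSpace.single i (1 : ℝ))
      simp only [EuclideanSpace.inner_single_left] at this
      simpa using this.const_mul (‖v‖ ^ 2)
  rw [← Finset.sum_congr rfl (fun i _ => key i), Finset.sum_const, Finset.card_fin,
    nsmul_eq_mul] at hsum
  have : (d : ℝ) ≠ 0 := by positivity
  field_simp
  linarith

/-! ### The random gradient estimator of a smooth function -/

/-- The random gradient estimator of `∇g(x)` along one direction `u`. -/
def rgeDir (μ : ℝ) (g : Vec d → ℝ) (x u : Vec d) : Vec d :=
  (((d : ℝ) * (g (x + μ • u) - g x)) / μ) • u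

theorem measurable_rgeDir {g : Vec d → ℝ} (hg : Continuous g) (μ : ℝ) (x : Vec d) :
    Measurable (rgeDir μ g x) := by
  unfold rgeDir
  have : Continuous fun u => g (x + μ • u) := hg.comp (by fun_prop)
  exact Continuous.measurable (by fun_prop)

theorem LSmooth.norm_rgeDir_le {L : ℝ} (hL : 0 ≤ L) {g : Vec d → ℝ} (hg : LSmooth L g)
    {μ : ℝ} (hμ : 0 < μ) (x : Vec d) {u : Vec d} (hu : ‖u‖ = 1) :
    ‖rgeDir μ g x u‖ ≤ d * |inner ℝ (gradient g x) u| + d * (L * μ) := by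
  have h := hg.abs_add_sub_inner_le hL x (μ • u)
  rw [norm_smul, hu, mul_one, Real.norm_of_nonneg hμ.le, inner_smul_right] at h
  have h2 : |g (x + μ • u) - g x| ≤ μ * |inner ℝ (gradient g x) u| + L * μ ^ 2 := by
    calc _ = |(g (x + μ • u) - g x - μ * inner ℝ (gradient g x) u)
              + μ * inner ℝ (gradient g x) u| := by ring_nf
      _ ≤ _ := (abs_add_le _ _).trans (by rw [abs_mul, abs_of_pos hμ]; linarith)
  rw [rgeDir, norm_smul, hu, mul_one, Real.norm_eq_abs, abs_div, abs_mul, abs_of_pos hμ,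
    Nat.abs_cast, div_le_iff₀ hμ]
  calc _ ≤ (d : ℝ) * (μ * |inner ℝ (gradient g x) u| + L * μ ^ 2) := by gcongr
    _ = _ := by ring

theorem LSmooth.norm_rgeDir_le_const {L : ℝ} (hL : 0 ≤ L) {g : Vec d → ℝ} (hg : LSmooth L g)
    {μ : ℝ} (hμ : 0 < μ) (x : Vec d) {u : Vec d} (hu : ‖u‖ = 1) :
    ‖rgeDir μ g x u‖ ≤ d * ‖gradient g x‖ + d * (L * μ) := by
  refine (hg.norm_rgeDir_le hL hμ x hu).trans ?_
  gcongr
  simpa [hu] using abs_real_inner_le_norm (gradient g x) u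

theorem LSmooth.memLp_rgeDir (hd : 1 ≤ d) {L : ℝ} (hL : 0 ≤ L) {g : Vec d → ℝ}
    (hg : LSmooth L g) {μ : ℝ} (hμ : 0 < μ) (x : Vec d) (q : ENNReal) :
    MemLp (rgeDir μ g x) q (sphereUniform d) := by
  have := isProbabilityMeasure_sphereUniform hd
  refine MemLp.of_bound (measurable_rgeDir hg.continuous μ x).aestronglyMeasurable
    (d * ‖gradient g x‖ + d * (L * μ)) ?_
  filter_upwards [ae_norm_eq_one_sphereUniform] with u hu using hg.norm_rgeDir_le_const hL hμ x hu

/-- The bias of the random gradient estimator is at most `L μ`, without a dimensional factor. The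
reflection along `v` preserves the distribution of `u`, and the increment of `g` between the two
reflected points is along `v`. -/
theorem LSmooth.abs_integral_inner_rgeDir_sub_le (hd : 1 ≤ d) {L : ℝ} (hL : 0 ≤ L)
    {g : Vec d → ℝ} (hg : LSmooth L g) {μ : ℝ} (hμ : 0 < μ) (x v : Vec d) :
    |∫ u, inner ℝ v (rgeDir μ g x u) ∂(sphereUniform d) - inner ℝ v (gradient g x)|
      ≤ L * μ * ‖v‖ := by
  have := isProbabilityMeasure_sphereUniform hd
  rcases eq_or_ne v 0 with rfl | hv
  · simp
  have hv' : 0 < ‖v‖ := norm_pos_iff.2 hv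
  have hd' : (0 : ℝ) < d := by positivity
  set h : Vec d → ℝ := fun u => inner ℝ v (rgeDir μ g x u) with hh
  have hint : Integrable h (sphereUniform d) :=
    ((hg.memLp_rgeDir hd hL hμ x 1).integrable le_rfl).const_inner v
  set ρ := (Submodule.span ℝ {v})ᗮ.reflection with hρdef
  have hρ : ∀ u, u - ρ u = (2 * inner ℝ v u / ‖v‖ ^ 2) • v := by
    intro u
    rw [hρdef, Submodule.reflection_orthogonal_apply, Submodule.reflection_apply,
      Submodule.starProjection_singleton]
    simp only [RCLike.ofReal_real_eq_id, id]
    rw [sub_neg_eq_add, add_sub_cancel, ← Nat.cast_smul_eq_nsmul ℝ, smul_smul]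
    congr 1
    push_cast
    ring
  have hρv : ρ v = -v := by
    have h1 := hρ v
    rw [real_inner_self_eq_norm_sq, mul_div_assoc, div_self (by positivity), mul_one,
      two_smul] at h1
    have : ρ v = v - (v + v) := by rw [← h1]; abel
    rw [this]; abel
  have hρinner : ∀ u, inner ℝ v (ρ u) = - inner ℝ v u := by
    intro u
    rw [← ρ.inner_map_map v u, hρv, inner_neg_left, neg_neg]
  have hmp := measurePreserving_sphereUniform ρ
  have hint2 : Integrable (fun u => h (ρ u)) (sphereUniform d) :=
    hmp.integrable_comp_of_integrable hint
  have hdouble : ∫ u, (h u + h (ρ u)) ∂(sphereUniform d) = 2 * ∫ u, h u ∂(sphereUniform d) := by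
    rw [integral_add hint hint2, hmp.integral_comp ρ.toHomeomorph.measurableEmbedding]
    ring
  have hsq := integrable_inner_sq_sphereUniform hd v
  have hpt : ∀ u, ‖u‖ = 1 → |(h u + h (ρ u))
      - (2 * d * inner ℝ v (gradient g x) / ‖v‖ ^ 2) * inner ℝ v u ^ 2|
        ≤ (2 * d * (L * μ) / ‖v‖) * inner ℝ v u ^ 2 := by
    intro u hu
    have hA := hg.abs_sub_sub_inner_le hL (x := x) (y := x + μ • u) (z := x + μ • ρ u) (r := μ)
      (by simp [norm_smul, hu, abs_of_pos hμ]) (by simp [norm_smul, hu, abs_of_pos hμ])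
    have e1 : (x + μ • u) - (x + μ • ρ u) = (μ * (2 * inner ℝ v u / ‖v‖ ^ 2)) • v := by
      rw [← smul_smul, ← hρ u]; module
    rw [e1, inner_smul_right, norm_smul, Real.norm_eq_abs, abs_mul, abs_of_pos hμ, abs_div, abs_mul,
      abs_two, abs_of_pos (pow_pos hv' 2), real_inner_comm v (gradient g x)] at hA
    have e2 : (h u + h (ρ u)) - (2 * d * inner ℝ v (gradient g x) / ‖v‖ ^ 2) * inner ℝ v u ^ 2
        = (d / μ * inner ℝ v u) * (g (x + μ • u) - g (x + μ • ρ u)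
            - μ * (2 * inner ℝ v u / ‖v‖ ^ 2) * inner ℝ v (gradient g x)) := by
      simp only [hh, rgeDir, inner_smul_right, hρinner]
      field_simp
      ring
    rw [e2, abs_mul, abs_mul, abs_div, abs_of_pos hμ, Nat.abs_cast]
    refine (mul_le_mul_of_nonneg_left hA (a := d / μ * |inner ℝ v u|) (by positivity)).trans
      (le_of_eq ?_)
    rw [← sq_abs (inner ℝ v u)]
    field_simp
  have hmain : |∫ u, ((h u + h (ρ u))
      - (2 * d * inner ℝ v (gradient g x) / ‖v‖ ^ 2) * inner ℝ v u ^ 2) ∂(sphereUniform d)|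
      ≤ ∫ u, (2 * d * (L * μ) / ‖v‖) * inner ℝ v u ^ 2 ∂(sphereUniform d) := by
    rw [← Real.norm_eq_abs]
    refine norm_integral_le_of_norm_le (hsq.const_mul _) ?_
    filter_upwards [ae_norm_eq_one_sphereUniform] with u hu using hpt u hu
  have hint3 : Integrable (fun u => h u + h (ρ u)) (sphereUniform d) := hint.add hint2
  rw [integral_sub hint3 (hsq.const_mul _), hdouble, integral_const_mul,
    integral_const_mul, integral_inner_sq_sphereUniform hd] at hmain
  have e3 : 2 * d * inner ℝ v (gradient g x) / ‖v‖ ^ 2 * (‖v‖ ^ 2 / d)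
      = 2 * inner ℝ v (gradient g x) := by field_simp
  have e4 : 2 * d * (L * μ) / ‖v‖ * (‖v‖ ^ 2 / d) = 2 * (L * μ * ‖v‖) := by field_simp
  rw [e3, e4, ← mul_sub, abs_mul, abs_two] at hmain
  linarith

/-- The prefactor `d` of the estimator is squared, but `⟨∇g(x), u⟩ ^ 2` has expectation
`‖∇g(x)‖ ^ 2 / d`, so that only one factor `d` is left in the leading term. -/
theorem LSmooth.integral_norm_rgeDir_sq_le (hd : 1 ≤ d) {L : ℝ} (hL : 0 ≤ L)
    {g : Vec d → ℝ} (hg : LSmooth L g) {μ : ℝ} (hμ : 0 < μ) (x : Vec d) :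
    ∫ u, ‖rgeDir μ g x u‖ ^ 2 ∂(sphereUniform d)
      ≤ 2 * d * ‖gradient g x‖ ^ 2 + 2 * d ^ 2 * (L * μ) ^ 2 := by
  have := isProbabilityMeasure_sphereUniform hd
  have hd' : (0 : ℝ) < d := by positivity
  have hsq := integrable_inner_sq_sphereUniform hd (gradient g x)
  calc ∫ u, ‖rgeDir μ g x u‖ ^ 2 ∂(sphereUniform d)
      ≤ ∫ u, (2 * d ^ 2 * inner ℝ (gradient g x) u ^ 2 + 2 * d ^ 2 * (L * μ) ^ 2)
          ∂(sphereUniform d) := by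
        refine integral_mono_ae (hg.memLp_rgeDir hd hL hμ x 2).integrable_norm_pow'
          ((hsq.const_mul _).add (integrable_const _)) ?_
        filter_upwards [ae_norm_eq_one_sphereUniform] with u hu
        have h1 := hg.norm_rgeDir_le hL hμ x hu
        calc ‖rgeDir μ g x u‖ ^ 2 ≤ (d * |inner ℝ (gradient g x) u| + d * (L * μ)) ^ 2 := by
              gcongr
          _ ≤ 2 * ((d * |inner ℝ (gradient g x) u|) ^ 2 + (d * (L * μ)) ^ 2) := add_sq_le
          _ = _ := by rw [mul_pow, sq_abs]; ring
    _ = _ := by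
        rw [integral_add (hsq.const_mul _) (integrable_const _), integral_const_mul,
          integral_inner_sq_sphereUniform hd]
        simp
        field_simp

theorem LSmooth.norm_integral_rgeDir_sub_le (hd : 1 ≤ d) {L : ℝ} (hL : 0 ≤ L)
    {g : Vec d → ℝ} (hg : LSmooth L g) {μ : ℝ} (hμ : 0 < μ) (x : Vec d) :
    ‖∫ u, rgeDir μ g x u ∂(sphereUniform d) - gradient g x‖ ≤ L * μ := by
  have := isProbabilityMeasure_sphereUniform hd
  set m := ∫ u, rgeDir μ g x u ∂(sphereUniform d) with hm
  have h := hg.abs_integral_inner_rgeDir_sub_le hd hL hμ x (m - gradient g x)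
  rw [integral_inner ((hg.memLp_rgeDir hd hL hμ x 1).integrable le_rfl), ← hm, ← inner_sub_right,
    real_inner_self_eq_norm_sq, abs_of_nonneg (by positivity)] at h
  rcases (norm_nonneg (m - gradient g x)).eq_or_lt with h0 | h0
  · rw [← h0]; positivity
  · nlinarith

section

variable {Ξ : Type*} {n : ℕ}

theorem rge_eq_sum_rgeDir (F : Vec d → Ξ → ℝ) (μ : ℝ) (u : Fin n → Vec d) (x : Vec d) (ξ : Ξ) :
    rge F μ u x ξ = (1 / (n : ℝ)) • ∑ i, rgeDir μ (fun z => F z ξ) x (u i) := rfl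

theorem LSmooth.memLp_rgeDir_eval (hd : 1 ≤ d) {L : ℝ} (hL : 0 ≤ L) {g : Vec d → ℝ}
    (hg : LSmooth L g) {μ : ℝ} (hμ : 0 < μ) (x : Vec d) (q : ENNReal) (i : Fin n) :
    MemLp (fun u : Fin n → Vec d => rgeDir μ g x (u i)) q
      (Measure.pi fun _ => sphereUniform d) := by
  have := isProbabilityMeasure_sphereUniform hd
  exact (hg.memLp_rgeDir hd hL hμ x q).comp_measurePreserving
    (measurePreserving_eval (fun _ : Fin n => sphereUniform d) i)

theorem LSmooth.memLp_rge (hd : 1 ≤ d) {L : ℝ} (hL : 0 ≤ L) {F : Vec d → Ξ → ℝ} {ξ : Ξ}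
    (hg : LSmooth L (fun z => F z ξ)) {μ : ℝ} (hμ : 0 < μ) (x : Vec d) (q : ENNReal) :
    MemLp (fun u : Fin n → Vec d => rge F μ u x ξ) q (Measure.pi fun _ => sphereUniform d) := by
  have := isProbabilityMeasure_sphereUniform hd
  simp only [rge_eq_sum_rgeDir]
  have h : MemLp (fun u : Fin n → Vec d => ∑ i, rgeDir μ (fun z => F z ξ) x (u i)) q
      (Measure.pi fun _ => sphereUniform d) :=
    memLp_finsetSum _ fun i _ => hg.memLp_rgeDir_eval hd hL hμ x q i
  exact h.const_smul (1 / (n : ℝ))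

theorem LSmooth.integral_rgeDir_eval (hd : 1 ≤ d) {L : ℝ} (hL : 0 ≤ L) {g : Vec d → ℝ}
    (hg : LSmooth L g) {μ : ℝ} (hμ : 0 < μ) (x : Vec d) (i : Fin n) :
    ∫ u : Fin n → Vec d, rgeDir μ g x (u i) ∂(Measure.pi fun _ => sphereUniform d)
      = ∫ u, rgeDir μ g x u ∂(sphereUniform d) := by
  have := isProbabilityMeasure_sphereUniform hd
  rw [integral_comp_eval (μ := fun _ : Fin n => sphereUniform d)
    (hg.memLp_rgeDir hd hL hμ x 1).aestronglyMeasurable]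

theorem LSmooth.integral_rge (hd : 1 ≤ d) (hn : 1 ≤ n) {L : ℝ} (hL : 0 ≤ L) {F : Vec d → Ξ → ℝ}
    {ξ : Ξ} (hg : LSmooth L (fun z => F z ξ)) {μ : ℝ} (hμ : 0 < μ) (x : Vec d) :
    ∫ u : Fin n → Vec d, rge F μ u x ξ ∂(Measure.pi fun _ => sphereUniform d)
      = ∫ u, rgeDir μ (fun z => F z ξ) x u ∂(sphereUniform d) := by
  have := isProbabilityMeasure_sphereUniform hd
  simp only [rge_eq_sum_rgeDir]
  rw [integral_smul, integral_finsetSum]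
  · simp only [hg.integral_rgeDir_eval hd hL hμ x]
    rw [Finset.sum_const, Finset.card_fin, ← Nat.cast_smul_eq_nsmul ℝ, smul_smul, one_div,
      inv_mul_cancel₀ (by positivity), one_smul]
  · intro i _
    exact (hg.memLp_rgeDir_eval hd hL hμ x 1 i).integrable le_rfl

theorem LSmooth.abs_integral_inner_rge_sub_le (hd : 1 ≤ d) (hn : 1 ≤ n) {L : ℝ} (hL : 0 ≤ L)
    {F : Vec d → Ξ → ℝ} {ξ : Ξ} (hg : LSmooth L (fun z => F z ξ)) {μ : ℝ} (hμ : 0 < μ)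
    (x v : Vec d) :
    |∫ u : Fin n → Vec d, inner ℝ v (rge F μ u x ξ) ∂(Measure.pi fun _ => sphereUniform d)
        - inner ℝ v (gradient (fun z => F z ξ) x)| ≤ L * μ * ‖v‖ := by
  have := isProbabilityMeasure_sphereUniform hd
  rw [integral_inner ((hg.memLp_rge hd hL hμ x 1).integrable le_rfl), hg.integral_rge hd hn hL hμ,
    ← integral_inner ((hg.memLp_rgeDir hd hL hμ x 1).integrable le_rfl)]
  exact hg.abs_integral_inner_rgeDir_sub_le hd hL hμ x v

/-- Averaging over `n` independent directions reduces the variance to a fraction `d / n` of the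
squared gradient; the squared mean does not depend on `n`. -/
theorem LSmooth.integral_norm_rge_sq_le (hd : 1 ≤ d) (hn : 1 ≤ n) {L : ℝ} (hL : 0 ≤ L)
    {F : Vec d → Ξ → ℝ} {ξ : Ξ} (hg : LSmooth L (fun z => F z ξ)) {μ : ℝ} (hμ : 0 < μ)
    (x : Vec d) :
    ∫ u : Fin n → Vec d, ‖rge F μ u x ξ‖ ^ 2 ∂(Measure.pi fun _ => sphereUniform d)
      ≤ 2 * dnr d n * (‖gradient (fun z => F z ξ) x‖ ^ 2 + d * (L * μ) ^ 2) := by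
  have := isProbabilityMeasure_sphereUniform hd
  set g : Vec d → ℝ := fun z => F z ξ with hgdef
  set ρ : Measure (Fin n → Vec d) := Measure.pi fun _ => sphereUniform d with hρ
  have hn' : (0 : ℝ) < n := by positivity
  have hd' : (1 : ℝ) ≤ d := by exact_mod_cast hd
  set m := ∫ u, rgeDir μ g x u ∂(sphereUniform d) with hm
  have hLp : ∀ k, MemLp (fun u => rgeDir μ g x u k) 2 (sphereUniform d) := fun k =>
    (EuclideanSpace.proj (𝕜 := ℝ) k).comp_memLp' (hg.memLp_rgeDir hd hL hμ x 2)
  have hLp' : ∀ k, MemLp (fun u : Fin n → Vec d => rge F μ u x ξ k) 2 ρ := fun k =>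
    (EuclideanSpace.proj (𝕜 := ℝ) k).comp_memLp' (hg.memLp_rge hd hL hμ x 2)
  have hcoord : ∀ k, ∫ u : Fin n → Vec d, (rge F μ u x ξ k) ^ 2 ∂ρ
      ≤ (1 / n) * (∫ u, (rgeDir μ g x u k) ^ 2 ∂(sphereUniform d)) + (m k) ^ 2 := by
    intro k
    have hmean : ∫ u : Fin n → Vec d, rge F μ u x ξ k ∂ρ = m k := by
      have h := (EuclideanSpace.proj (𝕜 := ℝ) k).integral_comp_comm
        ((hg.memLp_rge (n := n) hd hL hμ x 1).integrable le_rfl)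
      rw [hg.integral_rge hd hn hL hμ] at h
      exact h
    have hvar : Var[fun u : Fin n → Vec d => rge F μ u x ξ k; ρ]
        = (1 / n) * Var[fun u => rgeDir μ g x u k; sphereUniform d] := by
      have h1 : (fun u : Fin n → Vec d => rge F μ u x ξ k)
          = fun u => (1 / (n : ℝ)) * (∑ i, fun u : Fin n → Vec d => rgeDir μ g x (u i) k) u := by
        ext u
        simp [rge_eq_sum_rgeDir, Finset.sum_apply, hgdef]
      rw [h1, variance_const_mul, variance_sum_pi (μ := fun _ : Fin n => sphereUniform d)
        (X := fun _ u => rgeDir μ g x u k) (fun _ => hLp k)]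
      simp
      field_simp
    have hv1 := variance_eq_sub (hLp' k)
    have hv2 : Var[fun u => rgeDir μ g x u k; sphereUniform d]
      ≤ ∫ u, (rgeDir μ g x u k) ^ 2 ∂(sphereUniform d) :=
      variance_le_expectation_sq (hLp k).aestronglyMeasurable
    rw [hvar, hmean] at hv1
    simp only [Pi.pow_apply] at hv1
    have : (1 / n) * Var[fun u => rgeDir μ g x u k; sphereUniform d]
      ≤ (1 / n) * ∫ u, (rgeDir μ g x u k) ^ 2 ∂(sphereUniform d) := by gcongr
    linarith
  have hmn : ‖m‖ ≤ ‖gradient g x‖ + L * μ := by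
    have := hg.norm_integral_rgeDir_sub_le hd hL hμ x
    have h2 := norm_sub_norm_le m (gradient g x)
    linarith
  calc ∫ u : Fin n → Vec d, ‖rge F μ u x ξ‖ ^ 2 ∂ρ
      = ∑ k, ∫ u : Fin n → Vec d, (rge F μ u x ξ k) ^ 2 ∂ρ := by
        simp only [EuclideanSpace.real_norm_sq_eq]
        exact integral_finsetSum _ fun k _ => (hLp' k).integrable_sq
    _ ≤ ∑ k, ((1 / n) * (∫ u, (rgeDir μ g x u k) ^ 2 ∂(sphereUniform d)) + (m k) ^ 2) :=
        Finset.sum_le_sum fun k _ => hcoord k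
    _ = (1 / n) * (∫ u, ‖rgeDir μ g x u‖ ^ 2 ∂(sphereUniform d)) + ‖m‖ ^ 2 := by
        rw [Finset.sum_add_distrib, ← Finset.mul_sum, ← EuclideanSpace.real_norm_sq_eq]
        congr 2
        simp only [EuclideanSpace.real_norm_sq_eq]
        exact (integral_finsetSum _ fun k _ => (hLp k).integrable_sq).symm
    _ ≤ (1 / n) * (2 * d * ‖gradient g x‖ ^ 2 + 2 * d ^ 2 * (L * μ) ^ 2)
          + 2 * (‖gradient g x‖ ^ 2 + (L * μ) ^ 2) := by
        gcongr
        · exact hg.integral_norm_rgeDir_sq_le hd hL hμ x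
        · exact (pow_le_pow_left₀ (norm_nonneg _) hmn 2).trans add_sq_le
    _ ≤ _ := by
        have : (L * μ) ^ 2 ≤ d * (L * μ) ^ 2 := le_mul_of_one_le_left (sq_nonneg _) hd'
        have e : 2 * dnr d n * (‖gradient g x‖ ^ 2 + d * (L * μ) ^ 2)
          = (1 / n) * (2 * d * ‖gradient g x‖ ^ 2 + 2 * d ^ 2 * (L * μ) ^ 2)
          + 2 * (‖gradient g x‖ ^ 2 + d * (L * μ) ^ 2) := by
          unfold dnr
          field_simp
          ring
        linarith

end

/-! ### The objective and its stochastic gradient -/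

section

variable {α β : Type*} [MeasurableSpace α] [MeasurableSpace β]

/-- A nonnegative function with integrable sections is integrable on the product if its partial
integrals have an integrable bound. -/
theorem integrable_prod_of_integral_le {μ : Measure α} {ρ : Measure β} [SFinite μ] [SFinite ρ]
    {h : α × β → ℝ} (hm : AEStronglyMeasurable h (μ.prod ρ)) (h0 : ∀ p, 0 ≤ h p) {b : α → ℝ}
    (hb : Integrable b μ) (hi : ∀ᵐ a ∂μ, Integrable (fun y => h (a, y)) ρ)
    (hle : ∀ᵐ a ∂μ, ∫ y, h (a, y) ∂ρ ≤ b a) :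
    Integrable h (μ.prod ρ) ∧ ∫ p, h p ∂(μ.prod ρ) ≤ ∫ a, b a ∂μ := by
  have hint : Integrable h (μ.prod ρ) := by
    refine (integrable_prod_iff hm).2 ⟨hi, ?_⟩
    refine hb.mono' hm.norm.integral_prod_right' ?_
    filter_upwards [hle] with a ha
    simp only [Real.norm_of_nonneg (h0 _)]
    rwa [Real.norm_of_nonneg (integral_nonneg fun y => h0 _)]
  exact ⟨hint, by
    rw [integral_prod _ hint]
    exact integral_mono_ae hint.integral_prod_left hb hle⟩

end

section

variable {Ξ : Type*} [MeasurableSpace Ξ] {ν : Measure Ξ} {F : Vec d → Ξ → ℝ} {L : ℝ}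

theorem LipschitzGradient.ae_lSmooth (hs : LipschitzGradient ν F L) :
    ∀ᵐ ξ ∂ν, LSmooth L (fun z => F z ξ) := by
  filter_upwards [hs.differentiable, hs.lipschitz] with ξ h1 h2 using ⟨h1, h2⟩

theorem LipschitzGradient.aestronglyMeasurable_inner_gradient (hs : LipschitzGradient ν F L)
    (hL : 0 ≤ L) (x v : Vec d) :
    AEStronglyMeasurable (fun ξ => inner ℝ (gradient (fun z => F z ξ) x) v) ν := by
  -- the directional derivative is the limit of the difference quotients with steps `1 / (n + 1)`
  refine aestronglyMeasurable_of_tendsto_ae Filter.atTop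
    (f := fun (n : ℕ) ξ => ((n : ℝ) + 1) * (F (x + ((1 : ℝ) / ((n : ℝ) + 1)) • v) ξ - F x ξ))
    (fun n => ((hs.integrable _).sub (hs.integrable _)).aestronglyMeasurable.const_mul _) ?_
  filter_upwards [hs.ae_lSmooth] with ξ hg
  rw [tendsto_iff_norm_sub_tendsto_zero]
  have hlim : Filter.Tendsto (fun n : ℕ => (L * ‖v‖ ^ 2) * ((1 : ℝ) / ((n : ℝ) + 1))) Filter.atTop
      (nhds 0) := by
    simpa using tendsto_one_div_add_atTop_nhds_zero_nat.const_mul (L * ‖v‖ ^ 2)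
  refine squeeze_zero (fun _ => norm_nonneg _) (fun n => ?_) hlim
  have h := hg.abs_add_sub_inner_le hL x (((1 : ℝ) / ((n : ℝ) + 1)) • v)
  have hn : (0 : ℝ) < (n : ℝ) + 1 := by positivity
  rw [inner_smul_right, norm_smul, Real.norm_of_nonneg (by positivity)] at h
  set A := F (x + ((1 : ℝ) / ((n : ℝ) + 1)) • v) ξ
  set B := inner ℝ (gradient (fun z => F z ξ) x) v
  have e : ((n : ℝ) + 1) * (A - F x ξ) - B
      = ((n : ℝ) + 1) * (A - F x ξ - 1 / ((n : ℝ) + 1) * B) := by field_simp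
  rw [Real.norm_eq_abs, e, abs_mul, abs_of_pos hn]
  refine (mul_le_mul_of_nonneg_left h hn.le).trans (le_of_eq ?_)
  field_simp

theorem LipschitzGradient.integrable_gradient [IsFiniteMeasure ν] (hs : LipschitzGradient ν F L)
    (hL : 0 ≤ L) (x : Vec d) : Integrable (fun ξ => gradient (fun z => F z ξ) x) ν := by
  refine Integrable.of_eval_piLp fun i => ?_
  have hm := hs.aestronglyMeasurable_inner_gradient hL x (EuclideanSpace.single i (1 : ℝ))
  have hb : Integrable (fun ξ => ‖F (x + EuclideanSpace.single i (1 : ℝ)) ξ - F x ξ‖ + L) ν :=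
    ((hs.integrable _).sub (hs.integrable _)).norm.add (integrable_const _)
  have : Integrable (fun ξ => inner ℝ (gradient (fun z => F z ξ) x)
      (EuclideanSpace.single i (1 : ℝ))) ν := by
    refine hb.mono' hm ?_
    filter_upwards [hs.ae_lSmooth] with ξ hg
    have h := hg.abs_add_sub_inner_le hL x (EuclideanSpace.single i (1 : ℝ))
    simp only [PiLp.norm_single, norm_one, one_pow, mul_one] at h
    have h2 := abs_sub_abs_le_abs_sub (inner ℝ (gradient (fun z => F z ξ) x)
      (EuclideanSpace.single i (1 : ℝ))) (F (x + EuclideanSpace.single i (1 : ℝ)) ξ - F x ξ)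
    rw [abs_sub_comm (inner ℝ _ _) (_ - _)] at h2
    simp only [Real.norm_eq_abs]
    linarith
  simpa only [inner_single_one] using this

/-- The objective may be differentiated under the expectation. -/
theorem LipschitzGradient.hasGradientAt_objective [IsProbabilityMeasure ν]
    (hs : LipschitzGradient ν F L) (hL : 0 ≤ L) (x : Vec d) :
    HasGradientAt (objective ν F) (∫ ξ, gradient (fun z => F z ξ) x ∂ν) x := by
  rw [hasGradientAt_iff_isLittleO_nhds_zero]
  refine Asymptotics.IsBigO.trans_isLittleO (g := fun v : Vec d => ‖v‖ ^ 2) ?_ ?_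
  · refine Asymptotics.IsBigO.of_bound L (Filter.Eventually.of_forall fun v => ?_)
    have hint := hs.integrable_gradient hL x
    have hint2 : Integrable (fun ξ => inner ℝ (gradient (fun z => F z ξ) x) v) ν :=
      hint.inner_const v
    have e : inner ℝ (∫ ξ, gradient (fun z => F z ξ) x ∂ν) v
        = ∫ ξ, inner ℝ (gradient (fun z => F z ξ) x) v ∂ν := by
      rw [real_inner_comm, ← integral_inner hint]
      simp only [real_inner_comm]
    have hint3 : Integrable (fun ξ => F (x + v) ξ - F x ξ) ν :=
      (hs.integrable _).sub (hs.integrable _)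
    have e2 : objective ν F (x + v) - objective ν F x
        - inner ℝ (∫ ξ, gradient (fun z => F z ξ) x ∂ν) v
        = ∫ ξ, (F (x + v) ξ - F x ξ - inner ℝ (gradient (fun z => F z ξ) x) v) ∂ν := by
      rw [e, integral_sub hint3 hint2, integral_sub (hs.integrable _) (hs.integrable _)]
      rfl
    rw [e2, Real.norm_of_nonneg (sq_nonneg ‖v‖)]
    have := norm_integral_le_of_norm_le_const (μ := ν) (C := L * ‖v‖ ^ 2)
      (f := fun ξ => F (x + v) ξ - F x ξ - inner ℝ (gradient (fun z => F z ξ) x) v) (by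
        filter_upwards [hs.ae_lSmooth] with ξ hg
        exact hg.abs_add_sub_inner_le hL x v)
    simpa using this
  · exact Asymptotics.isLittleO_norm_pow_id (by norm_num)

theorem LipschitzGradient.gradient_objective [IsProbabilityMeasure ν]
    (hs : LipschitzGradient ν F L) (hL : 0 ≤ L) (x : Vec d) :
    gradient (objective ν F) x = ∫ ξ, gradient (fun z => F z ξ) x ∂ν :=
  (hs.hasGradientAt_objective hL x).gradient

theorem LipschitzGradient.continuous_objective [IsProbabilityMeasure ν]
    (hs : LipschitzGradient ν F L) (hL : 0 ≤ L) : Continuous (objective ν F) :=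
  continuous_iff_continuousAt.2 fun x =>
    (hs.hasGradientAt_objective hL x).differentiableAt.continuousAt

theorem LipschitzGradient.integral_inner_gradient [IsProbabilityMeasure ν]
    (hs : LipschitzGradient ν F L) (hL : 0 ≤ L) (x v : Vec d) :
    ∫ ξ, inner ℝ v (gradient (fun z => F z ξ) x) ∂ν = inner ℝ v (gradient (objective ν F) x) := by
  rw [integral_inner (hs.integrable_gradient hL x), hs.gradient_objective hL]

/-- The second moment of the stochastic gradient is bounded by the variance and the squared
gradient of the objective. -/
theorem LipschitzGradient.integral_norm_gradient_sq_le [IsProbabilityMeasure ν]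
    (hs : LipschitzGradient ν F L) (hL : 0 ≤ L) {K : Set (Vec d)} {ζ σ G : ℝ}
    (hζ : (d : ℝ) * ζ ^ 2 = σ ^ 2) (hv : BoundedVariance ν F K ζ)
    (hG : BoundedGradient (objective ν F) K G) {x : Vec d} (hx : x ∈ K) :
    Integrable (fun ξ => ‖gradient (fun z => F z ξ) x‖ ^ 2) ν ∧
      ∫ ξ, ‖gradient (fun z => F z ξ) x‖ ^ 2 ∂ν ≤ 2 * G ^ 2 + 2 * σ ^ 2 := by
  set m := gradient (objective ν F) x with hm
  have hmeas : ∀ i, AEStronglyMeasurable (fun ξ => gradient (fun z => F z ξ) x i) ν :=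
    fun i => ((hs.integrable_gradient hL x).eval_piLp i).aestronglyMeasurable
  have hvint : ∀ i, Integrable (fun ξ => (gradient (fun z => F z ξ) x i - m i) ^ 2) ν := by
    intro i
    refine ⟨((hmeas i).sub aestronglyMeasurable_const).pow 2, ?_⟩
    rw [hasFiniteIntegral_iff_ofReal (Filter.Eventually.of_forall fun _ => sq_nonneg _)]
    exact (hv x hx i).trans_lt ENNReal.ofReal_lt_top
  have hvle : ∀ i, ∫ ξ, (gradient (fun z => F z ξ) x i - m i) ^ 2 ∂ν ≤ ζ ^ 2 := by
    intro i
    rw [← ENNReal.ofReal_le_ofReal_iff (sq_nonneg _),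
      ofReal_integral_eq_lintegral_ofReal (hvint i)
        (Filter.Eventually.of_forall fun _ => sq_nonneg _)]
    exact hv x hx i
  have hsum : Integrable (fun ξ => 2 * ∑ i, (gradient (fun z => F z ξ) x i - m i) ^ 2
      + 2 * ‖m‖ ^ 2) ν :=
    ((integrable_finsetSum _ fun i _ => hvint i).const_mul 2).add (integrable_const _)
  have hpt : ∀ ξ, ‖gradient (fun z => F z ξ) x‖ ^ 2
      ≤ 2 * ∑ i, (gradient (fun z => F z ξ) x i - m i) ^ 2 + 2 * ‖m‖ ^ 2 := by
    intro ξ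
    rw [EuclideanSpace.real_norm_sq_eq, EuclideanSpace.real_norm_sq_eq, Finset.mul_sum,
      Finset.mul_sum, ← Finset.sum_add_distrib]
    refine Finset.sum_le_sum fun i _ => ?_
    have := add_sq_le (a := gradient (fun z => F z ξ) x i - m i) (b := m i)
    rw [sub_add_cancel] at this
    linarith
  have hint : Integrable (fun ξ => ‖gradient (fun z => F z ξ) x‖ ^ 2) ν := by
    refine hsum.mono' ((hs.integrable_gradient hL x).aestronglyMeasurable.norm.pow 2) ?_
    exact Filter.Eventually.of_forall fun ξ => by
      rw [Real.norm_of_nonneg (by positivity)]; exact hpt ξ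
  refine ⟨hint, ?_⟩
  calc _ ≤ ∫ ξ, (2 * ∑ i, (gradient (fun z => F z ξ) x i - m i) ^ 2 + 2 * ‖m‖ ^ 2) ∂ν :=
        integral_mono hint hsum hpt
    _ = 2 * ∑ i, ∫ ξ, (gradient (fun z => F z ξ) x i - m i) ^ 2 ∂ν + 2 * ‖m‖ ^ 2 := by
        rw [integral_add ((integrable_finsetSum _ fun i _ => hvint i).const_mul 2)
          (integrable_const _), integral_const_mul, integral_finsetSum _ fun i _ => hvint i]
        simp
    _ ≤ 2 * ∑ i : Fin d, ζ ^ 2 + 2 * G ^ 2 := by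
        gcongr with i
        · exact hvle i
        · exact hG x hx
    _ = _ := by simp [hζ]; ring

/-! ### Moments of the two estimators at a fixed point -/

theorem measurable_rge (hF : Measurable (Function.uncurry F)) (μ : ℝ) (n : ℕ) :
    Measurable fun q : Vec d × (Ξ × (Fin n → Vec d)) => rge F μ q.2.2 q.1 q.2.1 := by
  have h1 : Measurable fun q : Vec d × (Ξ × (Fin n → Vec d)) => F q.1 q.2.1 :=
    hF.comp (measurable_fst.prodMk measurable_snd.fst)
  have h2 : ∀ i, Measurable fun q : Vec d × (Ξ × (Fin n → Vec d)) =>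
      F (q.1 + μ • q.2.2 i) q.2.1 := fun i =>
    hF.comp (Measurable.prodMk (by fun_prop) measurable_snd.fst)
  unfold rge
  fun_prop

theorem measurable_rge_right (hF : Measurable (Function.uncurry F)) (μ : ℝ) (n : ℕ) (x : Vec d) :
    Measurable fun q : Ξ × (Fin n → Vec d) => rge F μ q.2 x q.1 := by
  have h1 : Measurable fun q : Ξ × (Fin n → Vec d) => (x, q) :=
    measurable_const.prodMk measurable_id
  have h2 := (measurable_rge hF μ n).comp h1
  exact h2

theorem LipschitzGradient.integral_norm_rge_sq_le [IsProbabilityMeasure ν] (hd : 1 ≤ d)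
    {n : ℕ} (hn : 1 ≤ n) (hs : LipschitzGradient ν F L) (hL : 0 ≤ L) {K : Set (Vec d)} {ζ σ G : ℝ}
    (hζ : (d : ℝ) * ζ ^ 2 = σ ^ 2) (hv : BoundedVariance ν F K ζ)
    (hG : BoundedGradient (objective ν F) K G) {x : Vec d} (hx : x ∈ K) {μ : ℝ} (hμ : 0 < μ) :
    Integrable (fun q : Ξ × (Fin n → Vec d) => ‖rge F μ q.2 x q.1‖ ^ 2)
        (ν.prod (Measure.pi fun _ => sphereUniform d)) ∧
      ∫ q : Ξ × (Fin n → Vec d), ‖rge F μ q.2 x q.1‖ ^ 2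
          ∂(ν.prod (Measure.pi fun _ => sphereUniform d))
        ≤ dnr d n * (4 * G ^ 2 + 4 * σ ^ 2 + 2 * (d * (L * μ) ^ 2)) := by
  have := isProbabilityMeasure_sphereUniform hd
  obtain ⟨hi, hle⟩ := hs.integral_norm_gradient_sq_le hL hζ hv hG hx
  have hd0 : 0 ≤ dnr d n := by unfold dnr; positivity
  have hmeas : Measurable fun q : Ξ × (Fin n → Vec d) => ‖rge F μ q.2 x q.1‖ ^ 2 :=
    (measurable_rge_right hs.measurable μ n x).norm.pow_const 2
  have h := integrable_prod_of_integral_le (μ := ν)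
    (ρ := Measure.pi fun _ : Fin n => sphereUniform d) hmeas.aestronglyMeasurable
    (fun _ => by positivity)
    (b := fun ξ => 2 * dnr d n * (‖gradient (fun z => F z ξ) x‖ ^ 2 + d * (L * μ) ^ 2))
    ((hi.add (integrable_const _)).const_mul _)
    (by
      filter_upwards [hs.ae_lSmooth] with ξ hg
      exact (hg.memLp_rge hd hL hμ x 2).integrable_norm_pow')
    (by
      filter_upwards [hs.ae_lSmooth] with ξ hg
      exact hg.integral_norm_rge_sq_le hd hn hL hμ x)
  refine ⟨h.1, h.2.trans ?_⟩
  rw [integral_const_mul, integral_add hi (integrable_const _)]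
  simp only [integral_const, probReal_univ, one_smul]
  nlinarith [mul_le_mul_of_nonneg_left hle hd0]

theorem LipschitzGradient.abs_integral_inner_rge_sub_le [IsProbabilityMeasure ν] (hd : 1 ≤ d)
    {n : ℕ} (hn : 1 ≤ n) (hs : LipschitzGradient ν F L) (hL : 0 ≤ L) {K : Set (Vec d)} {ζ σ G : ℝ}
    (hζ : (d : ℝ) * ζ ^ 2 = σ ^ 2) (hv : BoundedVariance ν F K ζ)
    (hG : BoundedGradient (objective ν F) K G) {x : Vec d} (hx : x ∈ K) {μ : ℝ} (hμ : 0 < μ)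
    (v : Vec d) :
    |∫ q : Ξ × (Fin n → Vec d), inner ℝ v (rge F μ q.2 x q.1)
          ∂(ν.prod (Measure.pi fun _ => sphereUniform d)) - inner ℝ v (gradient (objective ν F) x)|
      ≤ L * μ * ‖v‖ := by
  have := isProbabilityMeasure_sphereUniform hd
  have hmeas : Measurable fun q : Ξ × (Fin n → Vec d) => rge F μ q.2 x q.1 :=
    measurable_rge_right hs.measurable μ n x
  have hLp : MemLp (fun q : Ξ × (Fin n → Vec d) => rge F μ q.2 x q.1) 2
      (ν.prod (Measure.pi fun _ => sphereUniform d)) :=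
    (memLp_two_iff_integrable_sq_norm hmeas.aestronglyMeasurable).2
      (hs.integral_norm_rge_sq_le hd hn hL hζ hv hG hx hμ).1
  have hint : Integrable (fun q : Ξ × (Fin n → Vec d) => inner ℝ v (rge F μ q.2 x q.1))
      (ν.prod (Measure.pi fun _ => sphereUniform d)) :=
    (hLp.integrable one_le_two).const_inner v
  have hgi : Integrable (fun ξ => inner ℝ v (gradient (fun z => F z ξ) x)) ν :=
    (hs.integrable_gradient hL x).const_inner v
  rw [integral_prod _ hint, ← hs.integral_inner_gradient hL,
    ← integral_sub hint.integral_prod_left hgi]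
  have := norm_integral_le_of_norm_le_const (μ := ν) (C := L * μ * ‖v‖)
    (f := fun ξ => ∫ u : Fin n → Vec d, inner ℝ v (rge F μ u x ξ)
      ∂(Measure.pi fun _ => sphereUniform d) - inner ℝ v (gradient (fun z => F z ξ) x)) (by
      filter_upwards [hs.ae_lSmooth] with ξ hg
      exact hg.abs_integral_inner_rge_sub_le hd hn hL hμ x v)
  simpa using this

/-- The central difference quotient of the loss along the `i`-th coordinate. -/
def centralDiff (F : Vec d → Ξ → ℝ) (μ : ℝ) (i : Fin d) (x : Vec d) (ξ : Ξ) : ℝ :=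
  (F (x + μ • EuclideanSpace.single i (1 : ℝ)) ξ
      - F (x - μ • EuclideanSpace.single i (1 : ℝ)) ξ) / (2 * μ)

theorem measurable_centralDiff (hF : Measurable (Function.uncurry F)) (μ : ℝ) (i : Fin d) :
    Measurable fun q : Vec d × Ξ => centralDiff F μ i q.1 q.2 := by
  have h1 : Measurable fun q : Vec d × Ξ => F (q.1 + μ • EuclideanSpace.single i (1 : ℝ)) q.2 :=
    hF.comp (Measurable.prodMk (by fun_prop) measurable_snd)
  have h2 : Measurable fun q : Vec d × Ξ => F (q.1 - μ • EuclideanSpace.single i (1 : ℝ)) q.2 :=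
    hF.comp (Measurable.prodMk (by fun_prop) measurable_snd)
  exact (h1.sub h2).div_const _

omit [MeasurableSpace Ξ] in
theorem LSmooth.abs_centralDiff_sub_le (hL : 0 ≤ L) {ξ : Ξ} (hg : LSmooth L (fun z => F z ξ))
    {μ : ℝ} (hμ : 0 < μ) (i : Fin d) (x : Vec d) :
    |centralDiff F μ i x ξ - gradient (fun z => F z ξ) x i| ≤ L * μ := by
  set e : Vec d := EuclideanSpace.single i (1 : ℝ) with he
  have hn : ‖e‖ = 1 := by simp [he]
  have h := hg.abs_sub_sub_inner_le hL (x := x) (y := x + μ • e) (z := x - μ • e) (r := μ)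
    (by simp [norm_smul, hn, abs_of_pos hμ]) (by simp [norm_smul, hn, abs_of_pos hμ])
  have e1 : (x + μ • e) - (x - μ • e) = (2 * μ) • e := by module
  have e2 : inner ℝ (gradient (fun z => F z ξ) x) e = gradient (fun z => F z ξ) x i :=
    inner_single_one _ i
  rw [e1, inner_smul_right, norm_smul, hn, mul_one, e2, Real.norm_of_nonneg (by positivity)] at h
  have e3 : centralDiff F μ i x ξ - gradient (fun z => F z ξ) x i
      = (F (x + μ • e) ξ - F (x - μ • e) ξ - 2 * μ * gradient (fun z => F z ξ) x i) / (2 * μ) := by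
    unfold centralDiff
    field_simp
    rw [he]
  rw [e3, abs_div, abs_of_pos (by positivity : 0 < 2 * μ), div_le_iff₀ (by positivity)]
  exact h

theorem LipschitzGradient.integrable_centralDiff (hs : LipschitzGradient ν F L)
    (μ : ℝ) (i : Fin d) (x : Vec d) : Integrable (centralDiff F μ i x) ν :=
  ((hs.integrable _).sub (hs.integrable _)).div_const _

theorem LipschitzGradient.integral_sum_centralDiff_sq_le [IsProbabilityMeasure ν]
    (hs : LipschitzGradient ν F L) (hL : 0 ≤ L) {K : Set (Vec d)} {ζ σ G : ℝ}
    (hζ : (d : ℝ) * ζ ^ 2 = σ ^ 2) (hv : BoundedVariance ν F K ζ)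
    (hG : BoundedGradient (objective ν F) K G) {x : Vec d} (hx : x ∈ K) {μ : ℝ} (hμ : 0 < μ) :
    Integrable (fun ξ => ∑ i, centralDiff F μ i x ξ ^ 2) ν ∧
      ∫ ξ, ∑ i, centralDiff F μ i x ξ ^ 2 ∂ν
        ≤ 4 * G ^ 2 + 4 * σ ^ 2 + 2 * (d * (L * μ) ^ 2) := by
  obtain ⟨hi, hle⟩ := hs.integral_norm_gradient_sq_le hL hζ hv hG hx
  have hb : Integrable (fun ξ => 2 * ‖gradient (fun z => F z ξ) x‖ ^ 2 + 2 * (d * (L * μ) ^ 2)) ν :=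
    (hi.const_mul 2).add (integrable_const _)
  have hpt : ∀ᵐ ξ ∂ν, ∑ i, centralDiff F μ i x ξ ^ 2
      ≤ 2 * ‖gradient (fun z => F z ξ) x‖ ^ 2 + 2 * (d * (L * μ) ^ 2) := by
    filter_upwards [hs.ae_lSmooth] with ξ hg
    have e : 2 * ‖gradient (fun z => F z ξ) x‖ ^ 2 + 2 * (d * (L * μ) ^ 2)
        = ∑ i : Fin d, (2 * gradient (fun z => F z ξ) x i ^ 2 + 2 * (L * μ) ^ 2) := by
      rw [Finset.sum_add_distrib, ← Finset.mul_sum, ← EuclideanSpace.real_norm_sq_eq]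
      simp
      ring
    rw [e]
    refine Finset.sum_le_sum fun i _ => ?_
    have h1 := hg.abs_centralDiff_sub_le hL hμ i x
    have h2 := add_sq_le (a := centralDiff F μ i x ξ - gradient (fun z => F z ξ) x i)
      (b := gradient (fun z => F z ξ) x i)
    rw [sub_add_cancel] at h2
    have h3 : (centralDiff F μ i x ξ - gradient (fun z => F z ξ) x i) ^ 2 ≤ (L * μ) ^ 2 :=
      sq_le_sq' (by linarith [(abs_le.1 h1).1]) (abs_le.1 h1).2
    linarith
  have hint : Integrable (fun ξ => ∑ i, centralDiff F μ i x ξ ^ 2) ν := by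
    refine hb.mono' ?_ ?_
    · have : Measurable fun ξ => ∑ i, centralDiff F μ i x ξ ^ 2 :=
        Finset.measurable_sum _ fun i _ => ((measurable_centralDiff hs.measurable μ i).comp
          (measurable_const.prodMk measurable_id)).pow_const 2
      exact this.aestronglyMeasurable
    · filter_upwards [hpt] with ξ h
      rwa [Real.norm_of_nonneg (Finset.sum_nonneg fun _ _ => sq_nonneg _)]
  refine ⟨hint, (integral_mono_ae hint hb hpt).trans ?_⟩
  rw [integral_add (hi.const_mul 2) (integrable_const _), integral_const_mul]
  simp only [integral_const, probReal_univ, one_smul]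
  linarith

theorem sum_abs_le_sqrt_mul_norm (v : Vec d) : ∑ i, |v i| ≤ √(d : ℝ) * ‖v‖ := by
  rw [← Real.sqrt_sq (norm_nonneg v), ← Real.sqrt_mul (by positivity)]
  refine Real.le_sqrt_of_sq_le ?_
  have := sq_sum_le_card_mul_sum_sq (s := Finset.univ) (f := fun i => |v i|)
  simpa [EuclideanSpace.real_norm_sq_eq] using this

theorem LipschitzGradient.abs_integral_sum_centralDiff_sub_le [IsProbabilityMeasure ν]
    (hs : LipschitzGradient ν F L) (hL : 0 ≤ L) {μ : ℝ} (hμ : 0 < μ) (x v : Vec d) :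
    |∫ ξ, ∑ i, v i * centralDiff F μ i x ξ ∂ν - inner ℝ v (gradient (objective ν F) x)|
      ≤ L * μ * (√(d : ℝ) * ‖v‖) := by
  have hgi : Integrable (fun ξ => inner ℝ v (gradient (fun z => F z ξ) x)) ν :=
    (hs.integrable_gradient hL x).const_inner v
  have hsi : Integrable (fun ξ => ∑ i, v i * centralDiff F μ i x ξ) ν :=
    integrable_finsetSum _ fun i _ => (hs.integrable_centralDiff μ i x).const_mul _
  rw [← hs.integral_inner_gradient hL, ← integral_sub hsi hgi]
  have := norm_integral_le_of_norm_le_const (μ := ν) (C := L * μ * (√(d : ℝ) * ‖v‖))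
    (f := fun ξ => ∑ i, v i * centralDiff F μ i x ξ
      - inner ℝ v (gradient (fun z => F z ξ) x)) (by
      filter_upwards [hs.ae_lSmooth] with ξ hg
      have e : ∑ i, v i * centralDiff F μ i x ξ - inner ℝ v (gradient (fun z => F z ξ) x)
          = ∑ i, v i * (centralDiff F μ i x ξ - gradient (fun z => F z ξ) x i) := by
        simp only [mul_sub, Finset.sum_sub_distrib, inner_eq_sum_mul]
      rw [e, Real.norm_eq_abs]
      calc _ ≤ ∑ i, |v i| * (L * μ) := by
            refine (Finset.abs_sum_le_sum_abs _ _).trans (Finset.sum_le_sum fun i _ => ?_)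
            rw [abs_mul]
            gcongr
            exact hg.abs_centralDiff_sub_le hL hμ i x
        _ = L * μ * ∑ i, |v i| := by rw [← Finset.sum_mul, mul_comm]
        _ ≤ _ := by gcongr; exact sum_abs_le_sqrt_mul_norm v)
  simpa using this

end

/-! ### Independence and selection -/

section

variable {Ω α β : Type*} {mΩ : MeasurableSpace Ω} {P : Measure Ω} [IsProbabilityMeasure P]
  [MeasurableSpace α] [MeasurableSpace β] {X : Ω → α} {Y : Ω → β} {ρ : Measure β}

/-- For independent `X` and `Y` the variable `Y` may be resampled independently of all the
randomness in `X`. -/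
theorem map_prodMk_eq_map_prod_of_indepFun (hX : Measurable X) (hY : Measurable Y)
    (hXY : IndepFun X Y P) (hρ : P.map Y = ρ) :
    P.map (fun ω => (X ω, Y ω)) = (P.prod ρ).map (Prod.map X id) := by
  have : IsProbabilityMeasure ρ := hρ ▸ Measure.isProbabilityMeasure_map hY.aemeasurable
  rw [(indepFun_iff_map_prod_eq_prod_map_map hX.aemeasurable hY.aemeasurable).1 hXY, hρ,
    ← Measure.map_prod_map _ _ hX measurable_id, Measure.map_id]

theorem integrable_comp_prodMk_iff_of_indepFun (hX : Measurable X) (hY : Measurable Y)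
    (hXY : IndepFun X Y P) (hρ : P.map Y = ρ) {h : α × β → ℝ} (hh : Measurable h) :
    Integrable (fun ω => h (X ω, Y ω)) P ↔
      Integrable (fun q : Ω × β => h (X q.1, q.2)) (P.prod ρ) := by
  have h1 : Integrable h (P.map (fun ω => (X ω, Y ω))) ↔ Integrable (fun ω => h (X ω, Y ω)) P :=
    integrable_map_measure hh.aestronglyMeasurable (hX.prodMk hY).aemeasurable
  rw [← h1, map_prodMk_eq_map_prod_of_indepFun hX hY hXY hρ,
    integrable_map_measure hh.aestronglyMeasurable (hX.prodMap measurable_id).aemeasurable]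
  rfl

theorem integral_comp_prodMk_of_indepFun (hX : Measurable X) (hY : Measurable Y)
    (hXY : IndepFun X Y P) (hρ : P.map Y = ρ) {h : α × β → ℝ} (hh : Measurable h) :
    ∫ ω, h (X ω, Y ω) ∂P = ∫ q : Ω × β, h (X q.1, q.2) ∂(P.prod ρ) := by
  have h1 : ∫ q, h q ∂(P.map (fun ω => (X ω, Y ω))) = ∫ ω, h (X ω, Y ω) ∂P :=
    integral_map (hX.prodMk hY).aemeasurable hh.aestronglyMeasurable
  rw [← h1, map_prodMk_eq_map_prod_of_indepFun hX hY hXY hρ,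
    integral_map (hX.prodMap measurable_id).aemeasurable hh.aestronglyMeasurable]
  rfl

/-- An upper bound on the expectation over `Y` for fixed values of `X`, valid almost surely in `X`,
is a bound on the joint expectation if `X` and `Y` are independent. -/
theorem integral_le_of_indepFun (hX : Measurable X) (hY : Measurable Y)
    (hXY : IndepFun X Y P) (hρ : P.map Y = ρ) {h : α × β → ℝ} (hh : Measurable h)
    (h0 : ∀ q, 0 ≤ h q) {C : ℝ} (hi : ∀ᵐ ω ∂P, Integrable (fun y => h (X ω, y)) ρ)
    (hle : ∀ᵐ ω ∂P, ∫ y, h (X ω, y) ∂ρ ≤ C) :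
    Integrable (fun ω => h (X ω, Y ω)) P ∧ ∫ ω, h (X ω, Y ω) ∂P ≤ C := by
  have : IsProbabilityMeasure ρ := hρ ▸ Measure.isProbabilityMeasure_map hY.aemeasurable
  have hm : Measurable fun q : Ω × β => h (X q.1, q.2) := hh.comp (hX.prodMap measurable_id)
  have key := integrable_prod_of_integral_le (μ := P) (ρ := ρ) hm.aestronglyMeasurable
    (fun _ => h0 _) (integrable_const C) hi hle
  rw [integrable_comp_prodMk_iff_of_indepFun hX hY hXY hρ hh,
    integral_comp_prodMk_of_indepFun hX hY hXY hρ hh]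
  simpa using key

theorem le_integral_of_indepFun (hX : Measurable X) (hY : Measurable Y)
    (hXY : IndepFun X Y P) (hρ : P.map Y = ρ) {h : α × β → ℝ} (hh : Measurable h)
    (hi : Integrable (fun ω => h (X ω, Y ω)) P) {k : Ω → ℝ} (hk : Integrable k P)
    (hle : ∀ᵐ ω ∂P, k ω ≤ ∫ y, h (X ω, y) ∂ρ) :
    ∫ ω, k ω ∂P ≤ ∫ ω, h (X ω, Y ω) ∂P := by
  have : IsProbabilityMeasure ρ := hρ ▸ Measure.isProbabilityMeasure_map hY.aemeasurable
  rw [integrable_comp_prodMk_iff_of_indepFun hX hY hXY hρ hh] at hi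
  rw [integral_comp_prodMk_of_indepFun hX hY hXY hρ hh, integral_prod _ hi]
  exact integral_mono_ae hk hi.integral_prod_left hle

/-- If `A` has conditional probability `p` given `m`, the indicator of `A` may be replaced by `p`
in the expectation of a product with an `m`-measurable variable. -/
theorem integral_indicator_eq_integral_mul_of_condExp {m : MeasurableSpace Ω} (hm : m ≤ mΩ)
    {A : Set Ω} (hA : MeasurableSet[mΩ] A) {p : Ω → ℝ}
    (hp : P[A.indicator (fun _ => (1 : ℝ)) | m] =ᵐ[P] p) {Z : Ω → ℝ} (hZm : Measurable[m] Z)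
    (hZ : Integrable Z P) :
    Integrable (fun ω => p ω * Z ω) P ∧ ∫ ω, A.indicator Z ω ∂P = ∫ ω, p ω * Z ω ∂P := by
  have h1 : Integrable (A.indicator (fun _ => (1 : ℝ))) P := (integrable_const 1).indicator hA
  have e : A.indicator (fun _ => (1 : ℝ)) * Z = A.indicator Z := by
    ext ω
    by_cases h : ω ∈ A <;> simp [h]
  have hAZ : Integrable (A.indicator (fun _ => (1 : ℝ)) * Z) P := e ▸ hZ.indicator hA
  have h2 := condExp_mul_of_stronglyMeasurable_right hZm.stronglyMeasurable hAZ h1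
  have h3 : P[A.indicator (fun _ => (1 : ℝ)) * Z | m] =ᵐ[P] fun ω => p ω * Z ω := by
    filter_upwards [h2, hp] with ω e1 e2
    rw [e1, Pi.mul_apply, e2]
  refine ⟨integrable_condExp.congr h3, ?_⟩
  rw [← integral_congr_ae h3, integral_condExp hm, e]

end

/-! ### Measurability, laws and independence in a run of the algorithm -/

section

variable {Ω Ξ : Type*} [MeasurableSpace Ω] [MeasurableSpace Ξ] {F : Vec d → Ξ → ℝ}

theorem measurable_batchMean {b : ℕ} {g : Ω → Fin b → Vec d} (hg : ∀ j, Measurable fun ω => g ω j) :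
    Measurable fun ω => batchMean (g ω) := by
  unfold batchMean
  fun_prop

theorem measurable_rge_comp (hF : Measurable (Function.uncurry F)) (μ : ℝ) {n : ℕ}
    {x : Ω → Vec d} {ξ : Ω → Ξ} {u : Ω → Fin n → Vec d} (hx : Measurable x) (hξ : Measurable ξ)
    (hu : Measurable u) : Measurable fun ω => rge F μ (u ω) (x ω) (ξ ω) := by
  have h := (measurable_rge hF μ n).comp (hx.prodMk (hξ.prodMk hu))
  exact h

omit [MeasurableSpace Ξ] in
theorem cge_eq_sum_centralDiff (μ : ℝ) (I : Finset (Fin d)) (p : Fin d → ℝ) (x : Vec d) (ξ : Ξ) :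
    cge F μ I p x ξ = ∑ i, ((if i ∈ I then (1 : ℝ) else 0) / p i) •
      centralDiff F μ i x ξ • EuclideanSpace.single i (1 : ℝ) := rfl

omit [MeasurableSpace Ξ] in
theorem cge_apply (μ : ℝ) (I : Finset (Fin d)) (p : Fin d → ℝ) (x : Vec d) (ξ : Ξ) (i : Fin d) :
    cge F μ I p x ξ i = (if i ∈ I then (1 : ℝ) else 0) * (centralDiff F μ i x ξ / p i) := by
  rw [cge_eq_sum_centralDiff]
  simp [Pi.single_apply]
  split_ifs <;> ring

theorem measurable_centralDiff_comp (hF : Measurable (Function.uncurry F)) (μ : ℝ) (i : Fin d)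
    {x : Ω → Vec d} {ξ : Ω → Ξ} (hx : Measurable x) (hξ : Measurable ξ) :
    Measurable fun ω => centralDiff F μ i (x ω) (ξ ω) :=
  (measurable_centralDiff hF μ i).comp (hx.prodMk hξ)

theorem measurable_cge_comp (hF : Measurable (Function.uncurry F)) (μ : ℝ)
    {x : Ω → Vec d} {ξ : Ω → Ξ} {p : Ω → Fin d → ℝ} {I : Ω → Finset (Fin d)} (hx : Measurable x)
    (hξ : Measurable ξ) (hp : Measurable p) (hI : Measurable[_, ⊤] I) :
    Measurable fun ω => cge F μ (I ω) (p ω) (x ω) (ξ ω) := by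
  simp only [cge_eq_sum_centralDiff]
  refine Finset.measurable_sum _ fun i _ => ?_
  have h1 : Measurable fun ω => if i ∈ I ω then (1 : ℝ) else 0 := by
    have : Measurable[⊤] fun J : Finset (Fin d) => if i ∈ J then (1 : ℝ) else 0 :=
      measurable_from_top
    exact this.comp hI
  have h2 := measurable_centralDiff_comp hF μ i hx hξ
  have h3 : Measurable fun ω => p ω i := (measurable_pi_apply i).comp hp
  exact (h1.div h3).smul (h2.smul measurable_const)

end

section

variable {Ω Ξ : Type*} [mΩ : MeasurableSpace Ω] [mΞ : MeasurableSpace Ξ] {F : Vec d → Ξ → ℝ}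
  {P : Measure Ω} {ν : Measure Ξ} {prm : Params} {x₀ : Vec d} {T : ℕ} {X : Trajectory d Ξ Ω prm}

omit mΩ in
theorem Trajectory.le_past (X : Trajectory d Ξ Ω prm) {s t : ℕ} (h : s < t) :
    X.rgeAlg s ⊔ X.cgeAlg s ⊔ MeasurableSpace.comap (X.I s) ⊤ ≤ X.past t :=
  le_iSup₂_of_le s (Finset.mem_range.2 h) le_rfl

omit mΩ in
theorem Trajectory.past_mono (X : Trajectory d Ξ Ω prm) {s t : ℕ} (h : s ≤ t) :
    X.past s ≤ X.past t :=
  iSup₂_le fun _ hr => X.le_past ((Finset.mem_range.1 hr).trans_le h)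

theorem IsRun.rgeAlg_le (hr : IsRun P ν F prm x₀ T X) {t : ℕ} (ht : t < T) : X.rgeAlg t ≤ mΩ :=
  sup_le (hr.measurable_ξr t ht).comap_le (hr.measurable_u t ht).comap_le

theorem IsRun.cgeAlg_le (hr : IsRun P ν F prm x₀ T X) {t : ℕ} (ht : t < T) : X.cgeAlg t ≤ mΩ :=
  (hr.measurable_ξc t ht).comap_le

theorem IsRun.past_le (hr : IsRun P ν F prm x₀ T X) {t : ℕ} (ht : t ≤ T) : X.past t ≤ mΩ :=
  iSup₂_le fun s hs =>
    have hs : s < T := (Finset.mem_range.1 hs).trans_le ht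
    sup_le (sup_le (hr.rgeAlg_le hs) (hr.cgeAlg_le hs)) (hr.measurable_I s hs).comap_le

/-- The iterate `x_t` is determined by the randomness of the steps before `t`. -/
theorem IsRun.measurable_x_past (hr : IsRun P ν F prm x₀ T X) (hF : Measurable (Function.uncurry F))
    {t : ℕ} (ht : t ≤ T) : Measurable[X.past t] (X.x t) := by
  induction t with
  | zero =>
    have : X.x 0 = fun _ => x₀ := funext hr.init
    rw [this]
    exact measurable_const
  | succ t ih =>
    have ht' : t < T := ht
    have hle := X.le_past (Nat.lt_succ_self t)
    have hR : X.rgeAlg t ≤ X.past (t + 1) := (le_sup_left.trans le_sup_left).trans hle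
    have hC : X.cgeAlg t ≤ X.past (t + 1) := (le_sup_right.trans le_sup_left).trans hle
    have hI : Measurable[X.past (t + 1), ⊤] (X.I t) :=
      Measurable.mono (comap_measurable (m := ⊤) (X.I t)) (le_sup_right.trans hle) le_rfl
    have hx : Measurable[X.past (t + 1)] (X.x t) :=
      (ih ht'.le).mono (X.past_mono t.le_succ) le_rfl
    have hξ : Measurable[X.past (t + 1)] (X.ξr t) :=
      (comap_measurable (X.ξr t)).mono (le_sup_left.trans hR) le_rfl
    have hu : Measurable[X.past (t + 1)] (X.u t) :=
      (comap_measurable (X.u t)).mono (le_sup_right.trans hR) le_rfl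
    have hξc : Measurable[X.past (t + 1)] (X.ξc t) :=
      (comap_measurable (X.ξc t)).mono hC le_rfl
    have hp : Measurable[X.past (t + 1)] (X.p t) :=
      (hr.measurable_p t ht').mono (sup_le (X.past_mono t.le_succ) hR) le_rfl
    have hgR : Measurable[X.past (t + 1)] (X.gradR F t) :=
      @measurable_batchMean d Ω (X.past (t + 1)) _ _ fun j =>
        @measurable_rge_comp d Ω Ξ (X.past (t + 1)) _ F hF _ _ _ _ _ hx
          ((measurable_pi_apply j).comp hξ) ((measurable_pi_apply j).comp hu)
    have hgC : Measurable[X.past (t + 1)] (X.gradC F t) :=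
      @measurable_batchMean d Ω (X.past (t + 1)) _ _ fun j =>
        @measurable_cge_comp d Ω Ξ (X.past (t + 1)) _ F hF _ _ _ _ _ hx
          ((measurable_pi_apply j).comp hξc) hp hI
    rw [show X.x (t + 1) = X.x t - prm.η t • (prm.α t • X.gradR F t +
      (1 - prm.α t) • X.gradC F t) from funext (hr.step t ht')]
    exact hx.sub (((hgR.const_smul _).add (hgC.const_smul _)).const_smul _)

theorem IsRun.measurable_x (hr : IsRun P ν F prm x₀ T X) (hF : Measurable (Function.uncurry F))
    {t : ℕ} (ht : t ≤ T) : Measurable (X.x t) :=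
  (hr.measurable_x_past hF ht).mono (hr.past_le ht) le_rfl

theorem IsRun.measurable_p_ambient (hr : IsRun P ν F prm x₀ T X) {t : ℕ} (ht : t < T) :
    Measurable (X.p t) :=
  (hr.measurable_p t ht).mono (sup_le (hr.past_le ht.le) (hr.rgeAlg_le ht)) le_rfl

theorem IsRun.map_rge (hd : 1 ≤ d) [IsProbabilityMeasure ν] (hr : IsRun P ν F prm x₀ T X) {t : ℕ}
    (ht : t < T) (j : Fin (prm.br t)) :
    P.map (fun ω => (X.ξr t ω j, X.u t ω j)) =
      ν.prod (Measure.pi fun _ : Fin prm.nr => sphereUniform d) := by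
  have := isProbabilityMeasure_sphereUniform hd
  set S : Measure (Fin prm.nr → Vec d) := Measure.pi fun _ => sphereUniform d with hS
  have h1 : P.map (fun ω => (X.ξr t ω j, X.u t ω j)) =
      (P.map (fun ω => (X.ξr t ω, X.u t ω, X.ξc t ω))).map (fun q => (q.1 j, q.2.1 j)) := by
    rw [Measure.map_map (by fun_prop) ((hr.measurable_ξr t ht).prodMk
      ((hr.measurable_u t ht).prodMk (hr.measurable_ξc t ht)))]
    rfl
  have h2 := (measurePreserving_eval (fun _ : Fin (prm.br t) => ν) j).prod
    ((measurePreserving_eval (fun _ : Fin (prm.br t) => S) j).comp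
      (measurePreserving_fst (μ := Measure.pi fun _ : Fin (prm.br t) => S)
        (ν := Measure.pi fun _ : Fin (prm.bc t) => ν)))
  rw [h1, hr.law t ht]
  exact h2.map_eq

theorem IsRun.map_cge (hd : 1 ≤ d) [IsProbabilityMeasure ν] (hr : IsRun P ν F prm x₀ T X) {t : ℕ}
    (ht : t < T) (j : Fin (prm.bc t)) : P.map (fun ω => X.ξc t ω j) = ν := by
  have := isProbabilityMeasure_sphereUniform hd
  set S : Measure (Fin (prm.br t) → Fin prm.nr → Vec d) :=
    Measure.pi fun _ => Measure.pi fun _ => sphereUniform d with hS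
  have h1 : P.map (fun ω => X.ξc t ω j) =
      (P.map (fun ω => (X.ξr t ω, X.u t ω, X.ξc t ω))).map (fun q => q.2.2 j) := by
    rw [Measure.map_map (by fun_prop) ((hr.measurable_ξr t ht).prodMk
      ((hr.measurable_u t ht).prodMk (hr.measurable_ξc t ht)))]
    rfl
  have h2 := ((measurePreserving_eval (fun _ : Fin (prm.bc t) => ν) j).comp
    (measurePreserving_snd (μ := S) (ν := Measure.pi fun _ : Fin (prm.bc t) => ν))).comp
      (measurePreserving_snd (μ := Measure.pi fun _ : Fin (prm.br t) => ν)
        (ν := S.prod (Measure.pi fun _ : Fin (prm.bc t) => ν)))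
  rw [h1, hr.law t ht]
  exact h2.map_eq

theorem IsRun.indepFun_x (hr : IsRun P ν F prm x₀ T X) (hF : Measurable (Function.uncurry F))
    {t : ℕ} (ht : t < T) {β : Type*} [MeasurableSpace β] {Y : Ω → β}
    (hY : Measurable[X.rgeAlg t ⊔ X.cgeAlg t] Y) : IndepFun (X.x t) Y P := by
  rw [IndepFun_iff_Indep]
  exact indep_of_indep_of_le_left (indep_of_indep_of_le_right (hr.indep t ht) hY.comap_le)
    (hr.measurable_x_past hF ht.le).comap_le

theorem IsRun.indepFun_x_rge (hr : IsRun P ν F prm x₀ T X) (hF : Measurable (Function.uncurry F))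
    {t : ℕ} (ht : t < T) (j : Fin (prm.br t)) :
    IndepFun (X.x t) (fun ω => (X.ξr t ω j, X.u t ω j)) P := by
  refine hr.indepFun_x hF ht ?_
  have h1 : Measurable[X.rgeAlg t ⊔ X.cgeAlg t] (X.ξr t) :=
    (comap_measurable (X.ξr t)).mono (le_sup_left.trans le_sup_left) le_rfl
  have h2 : Measurable[X.rgeAlg t ⊔ X.cgeAlg t] (X.u t) :=
    (comap_measurable (X.u t)).mono (le_sup_right.trans le_sup_left) le_rfl
  exact ((measurable_pi_apply j).comp h1).prodMk ((measurable_pi_apply j).comp h2)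

theorem IsRun.indepFun_x_cge (hr : IsRun P ν F prm x₀ T X) (hF : Measurable (Function.uncurry F))
    {t : ℕ} (ht : t < T) (j : Fin (prm.bc t)) : IndepFun (X.x t) (fun ω => X.ξc t ω j) P := by
  refine hr.indepFun_x hF ht ?_
  have h1 : Measurable[X.rgeAlg t ⊔ X.cgeAlg t] (X.ξc t) :=
    (comap_measurable (X.ξc t)).mono le_sup_right le_rfl
  exact (measurable_pi_apply j).comp h1

end

/-! ### Mini-batches -/

section

variable {Ω : Type*} [MeasurableSpace Ω] {P : Measure Ω}

/-- Convexity of the squared norm; the terms of the mini-batch need not be independent. -/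
theorem norm_batchMean_sq_le {b : ℕ} (hb : 1 ≤ b) (g : Fin b → Vec d) :
    ‖batchMean g‖ ^ 2 ≤ (1 / (b : ℝ)) * ∑ j, ‖g j‖ ^ 2 := by
  have hb' : (0 : ℝ) < b := by positivity
  have h1 : ‖∑ j, g j‖ ^ 2 ≤ b * ∑ j, ‖g j‖ ^ 2 := by
    refine (pow_le_pow_left₀ (norm_nonneg _) (norm_sum_le _ _) 2).trans ?_
    simpa using sq_sum_le_card_mul_sum_sq (s := Finset.univ) (f := fun j => ‖g j‖)
  rw [batchMean, norm_smul, mul_pow, Real.norm_of_nonneg (by positivity)]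
  calc (1 / (b : ℝ)) ^ 2 * ‖∑ j, g j‖ ^ 2 ≤ (1 / (b : ℝ)) ^ 2 * (b * ∑ j, ‖g j‖ ^ 2) := by gcongr
    _ = _ := by field_simp

theorem integral_norm_batchMean_sq_le {b : ℕ} (hb : 1 ≤ b) {g : Ω → Fin b → Vec d} {C : ℝ}
    (hg : ∀ j, Measurable fun ω => g ω j)
    (h : ∀ j, Integrable (fun ω => ‖g ω j‖ ^ 2) P ∧ ∫ ω, ‖g ω j‖ ^ 2 ∂P ≤ C) :
    Integrable (fun ω => ‖batchMean (g ω)‖ ^ 2) P ∧ ∫ ω, ‖batchMean (g ω)‖ ^ 2 ∂P ≤ C := by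
  have hb' : (0 : ℝ) < b := by positivity
  have hi : Integrable (fun ω => (1 / (b : ℝ)) * ∑ j, ‖g ω j‖ ^ 2) P :=
    (integrable_finsetSum _ fun j _ => (h j).1).const_mul _
  have hint : Integrable (fun ω => ‖batchMean (g ω)‖ ^ 2) P := by
    refine hi.mono' ((measurable_batchMean hg).norm.pow_const 2).aestronglyMeasurable ?_
    refine Filter.Eventually.of_forall fun ω => ?_
    rw [Real.norm_of_nonneg (by positivity)]
    exact norm_batchMean_sq_le hb _
  refine ⟨hint, (integral_mono hint hi fun ω => norm_batchMean_sq_le hb _).trans ?_⟩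
  rw [integral_const_mul, integral_finsetSum _ fun j _ => (h j).1]
  calc (1 / (b : ℝ)) * ∑ j, ∫ ω, ‖g ω j‖ ^ 2 ∂P ≤ (1 / (b : ℝ)) * ∑ _j : Fin b, C := by
        gcongr with j; exact (h j).2
    _ = C := by simp; field_simp

theorem integrable_inner_of_sq {v g : Ω → Vec d} (hv : Measurable v) (hg : Measurable g)
    (hv2 : Integrable (fun ω => ‖v ω‖ ^ 2) P) (hg2 : Integrable (fun ω => ‖g ω‖ ^ 2) P) :
    Integrable (fun ω => inner ℝ (v ω) (g ω)) P := by
  refine (hv2.add hg2).mono' (hv.inner hg).aestronglyMeasurable ?_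
  refine Filter.Eventually.of_forall fun ω => (norm_inner_le_norm _ _).trans ?_
  simp only [Pi.add_apply]
  nlinarith [sq_nonneg (‖v ω‖ - ‖g ω‖), sq_nonneg (‖v ω‖ + ‖g ω‖)]

theorem le_integral_inner_batchMean {b : ℕ} (hb : 1 ≤ b) {v : Ω → Vec d} {g : Ω → Fin b → Vec d}
    {k : ℝ} (h : ∀ j, Integrable (fun ω => inner ℝ (v ω) (g ω j)) P)
    (hk : ∀ j, k ≤ ∫ ω, inner ℝ (v ω) (g ω j) ∂P) :
    k ≤ ∫ ω, inner ℝ (v ω) (batchMean (g ω)) ∂P := by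
  have hb' : (0 : ℝ) < b := by positivity
  simp only [batchMean, inner_smul_right, inner_sum]
  rw [integral_const_mul, integral_finsetSum _ fun j _ => h j]
  calc k = (1 / (b : ℝ)) * ∑ _j : Fin b, k := by simp; field_simp
    _ ≤ _ := by gcongr with j; exact hk j

end

/-! ### The two estimators along a run -/

section

variable {Ω Ξ : Type*} [mΩ : MeasurableSpace Ω] [mΞ : MeasurableSpace Ξ] {F : Vec d → Ξ → ℝ}
  {P : Measure Ω} [IsProbabilityMeasure P] {ν : Measure Ξ} [IsProbabilityMeasure ν]
  {K : Set (Vec d)} {L R G σ c : ℝ} {prm : Params} {T : ℕ} {X : Trajectory d Ξ Ω prm}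

omit [IsProbabilityMeasure P] [IsProbabilityMeasure ν] in
theorem Setting.measurable_x (hS : Setting P ν F K L R G σ c prm T X) {t : ℕ} (ht : t ≤ T) :
    Measurable (X.x t) := by
  obtain ⟨x₀, -, hr⟩ := hS.run
  exact hr.measurable_x hS.smooth.measurable ht

omit [IsProbabilityMeasure ν] in
theorem Setting.integrable_comp_x (hS : Setting P ν F K L R G σ c prm T X) {t : ℕ} (ht : t ≤ T)
    {φ : Vec d → ℝ} (hφ : Continuous φ) : Integrable (fun ω => φ (X.x t ω)) P := by
  obtain ⟨C, hC⟩ := hS.convex.isCompact.exists_bound_of_continuousOn hφ.continuousOn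
  refine Integrable.of_bound (hφ.measurable.comp (hS.measurable_x ht)).aestronglyMeasurable C ?_
  filter_upwards [hS.mem_domain t ht] with ω hω using hC _ hω

omit [IsProbabilityMeasure ν] in
/-- The selection probabilities are at most one, hence so is their lower bound `c`. -/
theorem Setting.c_le_one (hS : Setting P ν F K L R G σ c prm T X) : c ≤ 1 := by
  obtain ⟨x₀, -, hr⟩ := hS.run
  have hT : 0 < T := hS.T_pos
  let i : Fin d := ⟨0, hS.d_pos⟩
  have hI : MeasurableSet {ω | i ∈ X.I 0 ω} :=
    hr.measurable_I 0 hT (MeasurableSpace.measurableSet_top (s := {J : Finset (Fin d) | i ∈ J}))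
  have h1 : P[Set.indicator {ω | i ∈ X.I 0 ω} (fun _ => (1 : ℝ)) |
      X.past 0 ⊔ X.rgeAlg 0 ⊔ X.cgeAlg 0] ≤ᵐ[P]
      P[fun _ => (1 : ℝ) | X.past 0 ⊔ X.rgeAlg 0 ⊔ X.cgeAlg 0] :=
    condExp_mono ((integrable_const 1).indicator hI) (integrable_const 1)
      (Filter.Eventually.of_forall fun ω => Set.indicator_le_self' (fun _ _ => zero_le_one) ω)
  rw [condExp_const (sup_le (sup_le (hr.past_le hT.le) (hr.rgeAlg_le hT)) (hr.cgeAlg_le hT))] at h1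
  obtain ⟨ω, h1, h2, h3⟩ := (h1.and ((hr.select 0 hT i).and (hS.c_le 0 hT))).exists
  rw [h2] at h1
  exact (h3 i).trans h1

theorem Setting.integral_norm_rge_sq_le (hS : Setting P ν F K L R G σ c prm T X) (hL : 0 ≤ L)
    {t : ℕ} (ht : t < T) (j : Fin (prm.br t)) :
    Integrable (fun ω => ‖rge F prm.μr (X.u t ω j) (X.x t ω) (X.ξr t ω j)‖ ^ 2) P ∧
      ∫ ω, ‖rge F prm.μr (X.u t ω j) (X.x t ω) (X.ξr t ω j)‖ ^ 2 ∂P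
        ≤ dnr d prm.nr * (4 * G ^ 2 + 4 * σ ^ 2 + 2 * (d * (L * prm.μr) ^ 2)) := by
  obtain ⟨x₀, -, hr⟩ := hS.run
  obtain ⟨ζ, hζ, hv⟩ := hS.variance
  have hF := hS.smooth.measurable
  have hY : Measurable fun ω => (X.ξr t ω j, X.u t ω j) :=
    ((measurable_pi_apply j).comp (hr.measurable_ξr t ht)).prodMk
      ((measurable_pi_apply j).comp (hr.measurable_u t ht))
  have key : ∀ x ∈ K, _ := fun x hx => hS.smooth.integral_norm_rge_sq_le (n := prm.nr) hS.d_pos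
    hS.nr_pos hL hζ hv hS.boundedGradient hx hS.μr_pos
  exact integral_le_of_indepFun (hS.measurable_x ht.le) hY (hr.indepFun_x_rge hF ht j)
    (hr.map_rge hS.d_pos ht j)
    (h := fun q : Vec d × (Ξ × (Fin prm.nr → Vec d)) => ‖rge F prm.μr q.2.2 q.1 q.2.1‖ ^ 2)
    ((measurable_rge hF _ _).norm.pow_const 2) (fun _ => by positivity)
    (by filter_upwards [hS.mem_domain t ht.le] with ω hω using (key _ hω).1)
    (by filter_upwards [hS.mem_domain t ht.le] with ω hω using (key _ hω).2)

omit [IsProbabilityMeasure P] [IsProbabilityMeasure ν] in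
theorem Setting.measurable_rge (hS : Setting P ν F K L R G σ c prm T X) {t : ℕ} (ht : t < T)
    (j : Fin (prm.br t)) :
    Measurable fun ω => rge F prm.μr (X.u t ω j) (X.x t ω) (X.ξr t ω j) := by
  obtain ⟨x₀, -, hr⟩ := hS.run
  exact measurable_rge_comp hS.smooth.measurable _ (hS.measurable_x ht.le)
    ((measurable_pi_apply j).comp (hr.measurable_ξr t ht))
    ((measurable_pi_apply j).comp (hr.measurable_u t ht))

omit [IsProbabilityMeasure ν] in
theorem Setting.integrable_norm_sub_sq (hS : Setting P ν F K L R G σ c prm T X) {t : ℕ}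
    (ht : t ≤ T) (y : Vec d) : Integrable (fun ω => ‖X.x t ω - y‖ ^ 2) P :=
  hS.integrable_comp_x ht (φ := fun x => ‖x - y‖ ^ 2) (by fun_prop)

/-- A function `φ` that stays below the inner product of `x - y` with the gradient, by a margin for
a bias of norm at most `B`, bounds the expected inner product with the random estimator from
below. -/
theorem Setting.le_integral_inner_rge (hS : Setting P ν F K L R G σ c prm T X) (hL : 0 ≤ L)
    {t : ℕ} (ht : t < T) (j : Fin (prm.br t)) (y : Vec d) {B : ℝ} (hB : L * prm.μr ≤ B)
    {φ : Vec d → ℝ} (hφ : Continuous φ)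
    (hle : ∀ x ∈ K, φ x + B * ‖x - y‖ ≤ inner ℝ (x - y) (gradient (objective ν F) x)) :
    ∫ ω, φ (X.x t ω) ∂P
      ≤ ∫ ω, inner ℝ (X.x t ω - y) (rge F prm.μr (X.u t ω j) (X.x t ω) (X.ξr t ω j)) ∂P := by
  obtain ⟨x₀, -, hr⟩ := hS.run
  obtain ⟨ζ, hζ, hv⟩ := hS.variance
  have hF := hS.smooth.measurable
  have hY : Measurable fun ω => (X.ξr t ω j, X.u t ω j) :=
    ((measurable_pi_apply j).comp (hr.measurable_ξr t ht)).prodMk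
      ((measurable_pi_apply j).comp (hr.measurable_u t ht))
  refine le_integral_of_indepFun (hS.measurable_x ht.le) hY (hr.indepFun_x_rge hF ht j)
    (hr.map_rge hS.d_pos ht j)
    (h := fun q : Vec d × (Ξ × (Fin prm.nr → Vec d)) =>
      inner ℝ (q.1 - y) (rge F prm.μr q.2.2 q.1 q.2.1))
    ((measurable_fst.sub_const y).inner (ZOHGD.measurable_rge hF _ _))
    (integrable_inner_of_sq ((hS.measurable_x ht.le).sub_const y) (hS.measurable_rge ht j)
      (hS.integrable_norm_sub_sq ht.le y) (hS.integral_norm_rge_sq_le hL ht j).1)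
    (hS.integrable_comp_x ht.le hφ) ?_
  filter_upwards [hS.mem_domain t ht.le] with ω hω
  have h1 := hS.smooth.abs_integral_inner_rge_sub_le (n := prm.nr) hS.d_pos hS.nr_pos hL hζ hv
    hS.boundedGradient hω hS.μr_pos (X.x t ω - y)
  have h2 := hle _ hω
  have h3 : L * prm.μr * ‖X.x t ω - y‖ ≤ B * ‖X.x t ω - y‖ := by gcongr
  have h4 := (abs_le.1 h1).1
  linarith

theorem Setting.integral_centralDiff_sq_le (hS : Setting P ν F K L R G σ c prm T X) (hL : 0 ≤ L)
    {t : ℕ} (ht : t < T) (j : Fin (prm.bc t)) :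
    Integrable (fun ω => ∑ i, centralDiff F prm.μc i (X.x t ω) (X.ξc t ω j) ^ 2) P ∧
      ∫ ω, ∑ i, centralDiff F prm.μc i (X.x t ω) (X.ξc t ω j) ^ 2 ∂P
        ≤ 4 * G ^ 2 + 4 * σ ^ 2 + 2 * (d * (L * prm.μc) ^ 2) := by
  obtain ⟨x₀, -, hr⟩ := hS.run
  obtain ⟨ζ, hζ, hv⟩ := hS.variance
  have hF := hS.smooth.measurable
  have hY : Measurable fun ω => X.ξc t ω j :=
    (measurable_pi_apply j).comp (hr.measurable_ξc t ht)
  have key : ∀ x ∈ K, _ := fun x hx => hS.smooth.integral_sum_centralDiff_sq_le hL hζ hv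
    hS.boundedGradient hx hS.μc_pos
  exact integral_le_of_indepFun (hS.measurable_x ht.le) hY (hr.indepFun_x_cge hF ht j)
    (hr.map_cge hS.d_pos ht j)
    (h := fun q : Vec d × Ξ => ∑ i, centralDiff F prm.μc i q.1 q.2 ^ 2)
    (Finset.measurable_sum _ fun i _ => (measurable_centralDiff hF _ i).pow_const 2)
    (fun _ => by positivity)
    (by filter_upwards [hS.mem_domain t ht.le] with ω hω using (key _ hω).1)
    (by filter_upwards [hS.mem_domain t ht.le] with ω hω using (key _ hω).2)

omit [IsProbabilityMeasure P] [IsProbabilityMeasure ν] in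
theorem Setting.measurable_cge (hS : Setting P ν F K L R G σ c prm T X) {t : ℕ} (ht : t < T)
    (j : Fin (prm.bc t)) :
    Measurable fun ω => cge F prm.μc (X.I t ω) (X.p t ω) (X.x t ω) (X.ξc t ω j) := by
  obtain ⟨x₀, -, hr⟩ := hS.run
  exact measurable_cge_comp hS.smooth.measurable _ (hS.measurable_x ht.le)
    ((measurable_pi_apply j).comp (hr.measurable_ξc t ht)) (hr.measurable_p_ambient ht)
    (hr.measurable_I t ht)

omit [IsProbabilityMeasure P] [IsProbabilityMeasure ν] in
theorem Setting.measurable_centralDiff (hS : Setting P ν F K L R G σ c prm T X) {t : ℕ}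
    (ht : t < T) (j : Fin (prm.bc t)) (i : Fin d) :
    Measurable[X.past t ⊔ X.rgeAlg t ⊔ X.cgeAlg t]
      fun ω => centralDiff F prm.μc i (X.x t ω) (X.ξc t ω j) := by
  obtain ⟨x₀, -, hr⟩ := hS.run
  have h1 : Measurable[X.past t ⊔ X.rgeAlg t ⊔ X.cgeAlg t] (X.x t) :=
    (hr.measurable_x_past hS.smooth.measurable ht.le).mono (le_sup_left.trans le_sup_left) le_rfl
  have h2 : Measurable[X.past t ⊔ X.rgeAlg t ⊔ X.cgeAlg t] (X.ξc t) :=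
    (comap_measurable (X.ξc t)).mono le_sup_right le_rfl
  exact @measurable_centralDiff_comp d Ω Ξ (X.past t ⊔ X.rgeAlg t ⊔ X.cgeAlg t) _ F
    hS.smooth.measurable _ i _ _ h1 ((measurable_pi_apply j).comp h2)

theorem Setting.integrable_centralDiff_sq (hS : Setting P ν F K L R G σ c prm T X) (hL : 0 ≤ L)
    {t : ℕ} (ht : t < T) (j : Fin (prm.bc t)) (i : Fin d) :
    Integrable (fun ω => centralDiff F prm.μc i (X.x t ω) (X.ξc t ω j) ^ 2) P := by
  obtain ⟨x₀, -, hr⟩ := hS.run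
  have hle := sup_le (sup_le (hr.past_le ht.le) (hr.rgeAlg_le ht)) (hr.cgeAlg_le ht)
  refine (hS.integral_centralDiff_sq_le hL ht j).1.mono'
    (((hS.measurable_centralDiff ht j i).mono hle le_rfl).pow_const 2).aestronglyMeasurable ?_
  refine Filter.Eventually.of_forall fun ω => ?_
  rw [Real.norm_of_nonneg (sq_nonneg _)]
  exact Finset.single_le_sum (f := fun i => centralDiff F prm.μc i (X.x t ω) (X.ξc t ω j) ^ 2)
    (fun _ _ => sq_nonneg _) (Finset.mem_univ i)

omit [IsProbabilityMeasure ν] in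
/-- Averaging over the selection of the coordinate `i` cancels one factor `1 / p_{t,i}`. -/
theorem Setting.integral_select_div (hS : Setting P ν F K L R G σ c prm T X) {t : ℕ} (ht : t < T)
    (i : Fin d) {Z : Ω → ℝ} (hZ : Measurable[X.past t ⊔ X.rgeAlg t ⊔ X.cgeAlg t] Z)
    (hZi : Integrable Z P) :
    Integrable (fun ω => (if i ∈ X.I t ω then (1 : ℝ) else 0) * (Z ω / X.p t ω i)) P ∧
      ∫ ω, (if i ∈ X.I t ω then (1 : ℝ) else 0) * (Z ω / X.p t ω i) ∂P = ∫ ω, Z ω ∂P := by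
  obtain ⟨x₀, -, hr⟩ := hS.run
  have hle := sup_le (sup_le (hr.past_le ht.le) (hr.rgeAlg_le ht)) (hr.cgeAlg_le ht)
  have hI : MeasurableSet {ω | i ∈ X.I t ω} :=
    hr.measurable_I t ht (MeasurableSpace.measurableSet_top (s := {J : Finset (Fin d) | i ∈ J}))
  have hp : Measurable[X.past t ⊔ X.rgeAlg t ⊔ X.cgeAlg t] fun ω => X.p t ω i :=
    (measurable_pi_apply i).comp ((hr.measurable_p t ht).mono le_sup_left le_rfl)
  have hW : Measurable[X.past t ⊔ X.rgeAlg t ⊔ X.cgeAlg t] fun ω => Z ω / X.p t ω i := hZ.div hp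
  have hWi : Integrable (fun ω => Z ω / X.p t ω i) P := by
    refine (hZi.norm.div_const c).mono' (hW.mono hle le_rfl).aestronglyMeasurable ?_
    filter_upwards [hS.c_le t ht] with ω hω
    have hc := hS.c_pos
    rw [norm_div, Real.norm_of_nonneg (hc.le.trans (hω i))]
    gcongr
    exact hω i
  obtain ⟨-, h2⟩ := integral_indicator_eq_integral_mul_of_condExp hle hI (hr.select t ht i) hW hWi
  have e : (fun ω => (if i ∈ X.I t ω then (1 : ℝ) else 0) * (Z ω / X.p t ω i))
      = Set.indicator {ω | i ∈ X.I t ω} (fun ω => Z ω / X.p t ω i) := by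
    ext ω
    by_cases h : i ∈ X.I t ω <;> simp [h]
  rw [e]
  refine ⟨hWi.indicator hI, h2.trans (integral_congr_ae ?_)⟩
  filter_upwards [hS.c_le t ht] with ω hω
  exact mul_div_cancel₀ _ (hS.c_pos.trans_le (hω i)).ne'

/-- Of the two factors `1 / p_{t,i}` in the square, one is cancelled by the selection and the other
is at most `1 / c`. -/
theorem Setting.integral_norm_cge_sq_le (hS : Setting P ν F K L R G σ c prm T X) (hL : 0 ≤ L)
    {t : ℕ} (ht : t < T) (j : Fin (prm.bc t)) :
    Integrable (fun ω => ‖cge F prm.μc (X.I t ω) (X.p t ω) (X.x t ω) (X.ξc t ω j)‖ ^ 2) P ∧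
      ∫ ω, ‖cge F prm.μc (X.I t ω) (X.p t ω) (X.x t ω) (X.ξc t ω j)‖ ^ 2 ∂P
        ≤ (4 * G ^ 2 + 4 * σ ^ 2 + 2 * (d * (L * prm.μc) ^ 2)) / c := by
  obtain ⟨x₀, -, hr⟩ := hS.run
  have hc := hS.c_pos
  have hle := sup_le (sup_le (hr.past_le ht.le) (hr.rgeAlg_le ht)) (hr.cgeAlg_le ht)
  set q : Fin d → Ω → ℝ := fun i ω => centralDiff F prm.μc i (X.x t ω) (X.ξc t ω j) with hq
  have hZ : ∀ i, Measurable[X.past t ⊔ X.rgeAlg t ⊔ X.cgeAlg t] fun ω => q i ω ^ 2 / X.p t ω i :=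
    fun i => ((hS.measurable_centralDiff ht j i).pow_const 2).div
      ((measurable_pi_apply i).comp ((hr.measurable_p t ht).mono le_sup_left le_rfl))
  have hbd : ∀ i, ∀ᵐ ω ∂P, q i ω ^ 2 / X.p t ω i ≤ q i ω ^ 2 / c := by
    intro i
    filter_upwards [hS.c_le t ht] with ω hω
    gcongr
    exact hω i
  have hqi : ∀ i, Integrable (fun ω => q i ω ^ 2) P := hS.integrable_centralDiff_sq hL ht j
  have hZi : ∀ i, Integrable (fun ω => q i ω ^ 2 / X.p t ω i) P := by
    intro i
    refine ((hqi i).div_const c).mono' ((hZ i).mono hle le_rfl).aestronglyMeasurable ?_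
    filter_upwards [hbd i, hS.c_le t ht] with ω h1 h2
    rwa [Real.norm_of_nonneg (div_nonneg (sq_nonneg _) (hc.le.trans (h2 i)))]
  have e : (fun ω => ‖cge F prm.μc (X.I t ω) (X.p t ω) (X.x t ω) (X.ξc t ω j)‖ ^ 2)
      = fun ω => ∑ i, (if i ∈ X.I t ω then (1 : ℝ) else 0) *
          ((q i ω ^ 2 / X.p t ω i) / X.p t ω i) := by
    ext ω
    rw [EuclideanSpace.real_norm_sq_eq]
    refine Finset.sum_congr rfl fun i _ => ?_
    rw [cge_apply, hq]
    split_ifs <;> ring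
  rw [e]
  have hsel := fun i => hS.integral_select_div ht i (hZ i) (hZi i)
  refine ⟨integrable_finsetSum _ fun i _ => (hsel i).1, ?_⟩
  rw [integral_finsetSum _ fun i _ => (hsel i).1]
  calc _ ≤ ∑ i, (∫ ω, q i ω ^ 2 ∂P) / c := by
        refine Finset.sum_le_sum fun i _ => ?_
        rw [(hsel i).2, ← integral_div]
        exact integral_mono_ae (hZi i) ((hqi i).div_const c) (hbd i)
    _ = (∫ ω, ∑ i, q i ω ^ 2 ∂P) / c := by
        rw [integral_finsetSum _ fun i _ => hqi i, Finset.sum_div]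
    _ ≤ _ := by
        gcongr
        exact (hS.integral_centralDiff_sq_le hL ht j).2

/-- The analogue of `Setting.le_integral_inner_rge` for the coordinate-wise estimator. -/
theorem Setting.le_integral_inner_cge (hS : Setting P ν F K L R G σ c prm T X) (hL : 0 ≤ L)
    {t : ℕ} (ht : t < T) (j : Fin (prm.bc t)) (y : Vec d) {B : ℝ}
    (hB : L * prm.μc * √(d : ℝ) ≤ B) {φ : Vec d → ℝ} (hφ : Continuous φ)
    (hle : ∀ x ∈ K, φ x + B * ‖x - y‖ ≤ inner ℝ (x - y) (gradient (objective ν F) x)) :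
    ∫ ω, φ (X.x t ω) ∂P ≤ ∫ ω, inner ℝ (X.x t ω - y)
      (cge F prm.μc (X.I t ω) (X.p t ω) (X.x t ω) (X.ξc t ω j)) ∂P := by
  obtain ⟨x₀, -, hr⟩ := hS.run
  have hF := hS.smooth.measurable
  have hm := sup_le (sup_le (hr.past_le ht.le) (hr.rgeAlg_le ht)) (hr.cgeAlg_le ht)
  set q : Fin d → Ω → ℝ := fun i ω => centralDiff F prm.μc i (X.x t ω) (X.ξc t ω j) with hq
  set v : Ω → Vec d := fun ω => X.x t ω - y with hv
  have hvm : Measurable[X.past t ⊔ X.rgeAlg t ⊔ X.cgeAlg t] v :=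
    ((hr.measurable_x_past hF ht.le).mono (le_sup_left.trans le_sup_left) le_rfl).sub_const y
  have hZ : ∀ i, Measurable[X.past t ⊔ X.rgeAlg t ⊔ X.cgeAlg t] fun ω => v ω i * q i ω := by
    intro i
    have h1 : Measurable fun w : Vec d => w i := by fun_prop
    exact (h1.comp hvm).mul (hS.measurable_centralDiff ht j i)
  have hZi : ∀ i, Integrable (fun ω => v ω i * q i ω) P := by
    intro i
    have hvi : Integrable (fun ω => v ω i ^ 2) P :=
      hS.integrable_comp_x ht.le (φ := fun x => (x - y) i ^ 2) (by fun_prop)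
    refine (hvi.add (hS.integrable_centralDiff_sq hL ht j i)).mono'
      ((hZ i).mono hm le_rfl).aestronglyMeasurable ?_
    refine Filter.Eventually.of_forall fun ω => ?_
    rw [Real.norm_eq_abs, abs_le]
    simp only [Pi.add_apply]
    constructor <;> nlinarith [sq_nonneg (v ω i - q i ω), sq_nonneg (v ω i + q i ω)]
  have e : (fun ω => inner ℝ (v ω) (cge F prm.μc (X.I t ω) (X.p t ω) (X.x t ω) (X.ξc t ω j)))
      = fun ω => ∑ i, (if i ∈ X.I t ω then (1 : ℝ) else 0) * ((v ω i * q i ω) / X.p t ω i) := by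
    ext ω
    rw [inner_eq_sum_mul]
    refine Finset.sum_congr rfl fun i _ => ?_
    rw [cge_apply, hq]
    ring
  have hsel := fun i => hS.integral_select_div ht i (hZ i) (hZi i)
  rw [e, integral_finsetSum _ fun i _ => (hsel i).1, Finset.sum_congr rfl fun i _ => (hsel i).2,
    ← integral_finsetSum _ fun i _ => hZi i]
  have hY : Measurable fun ω => X.ξc t ω j :=
    (measurable_pi_apply j).comp (hr.measurable_ξc t ht)
  refine le_integral_of_indepFun (hS.measurable_x ht.le) hY (hr.indepFun_x_cge hF ht j)
    (hr.map_cge hS.d_pos ht j)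
    (h := fun q : Vec d × Ξ => ∑ i, (q.1 - y) i * centralDiff F prm.μc i q.1 q.2)
    (Finset.measurable_sum _ fun i _ => ?_)
    (integrable_finsetSum _ fun i _ => hZi i) (hS.integrable_comp_x ht.le hφ) ?_
  · have h1 : Measurable fun q : Vec d × Ξ => (q.1 - y) i := by fun_prop
    exact h1.mul (ZOHGD.measurable_centralDiff hF _ i)
  · filter_upwards [hS.mem_domain t ht.le] with ω hω
    have h1 := hS.smooth.abs_integral_sum_centralDiff_sub_le hL hS.μc_pos (X.x t ω) (X.x t ω - y)
    have h2 := hle _ hω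
    have h3 : L * prm.μc * √(d : ℝ) * ‖X.x t ω - y‖ ≤ B * ‖X.x t ω - y‖ := by gcongr
    have h4 := (abs_le.1 h1).1
    linarith

end

/-! ### The effective dimension -/

theorem one_le_dnr (d n : ℕ) : 1 ≤ dnr d n := by
  have : (0 : ℝ) ≤ (d : ℝ) / n := by positivity
  unfold dnr
  linarith

theorem half_le_effDim (d n : ℕ) {c : ℝ} (hc : 0 < c) (hc1 : c ≤ 1) : 1 / 2 ≤ effDim d n c := by
  have h := one_le_dnr d n
  unfold effDim
  rw [div_le_div_iff₀ two_pos (by positivity)]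
  nlinarith

section

variable {Ω Ξ : Type*} [mΩ : MeasurableSpace Ω] [mΞ : MeasurableSpace Ξ] {F : Vec d → Ξ → ℝ}
  {P : Measure Ω} [IsProbabilityMeasure P] {ν : Measure Ξ} [IsProbabilityMeasure ν]
  {K : Set (Vec d)} {L R G σ c : ℝ} {prm : Params} {T : ℕ} {X : Trajectory d Ξ Ω prm}

/-! ### The inequality for one step -/

/-- One step of the algorithm. Here `B` bounds the bias of both estimators, and `φ` is what the
convexity of the objective leaves of the inner product with the gradient after the bias has been
subtracted. The choice of `α` balances the second moments of the two estimators, which are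
proportional to `d_nr` and `1 / c`, so that both contribute a multiple of the effective
dimension. -/
theorem Setting.integral_norm_sub_sq_succ_le (hS : Setting P ν F K L R G σ c prm T X) (hL : 0 ≤ L)
    (hμr : d * (L * prm.μr) ^ 2 ≤ 4 * σ ^ 2) {t : ℕ} (ht : t < T)
    (hα : prm.α t = 1 / (1 + c * dnr d prm.nr)) (hη : 0 ≤ prm.η t) (y : Vec d) {B : ℝ}
    (hBr : L * prm.μr ≤ B) (hBc : L * prm.μc * √(d : ℝ) ≤ B) {φ : Vec d → ℝ} (hφ : Continuous φ)
    (hle : ∀ x ∈ K, φ x + B * ‖x - y‖ ≤ inner ℝ (x - y) (gradient (objective ν F) x)) :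
    ∫ ω, ‖X.x (t + 1) ω - y‖ ^ 2 ∂P ≤ ∫ ω, ‖X.x t ω - y‖ ^ 2 ∂P
      - 2 * prm.η t * ∫ ω, φ (X.x t ω) ∂P
      + prm.η t ^ 2 * (effDim d prm.nr c * (8 * G ^ 2 + 18 * σ ^ 2)) := by
  obtain ⟨x₀, -, hr⟩ := hS.run
  have hc := hS.c_pos
  have hdn := one_le_dnr d prm.nr
  set α := prm.α t with hαdef
  set η := prm.η t with hηdef
  have hden : 0 < 1 + c * dnr d prm.nr := by positivity
  have hα0 : 0 ≤ α := by rw [hα]; positivity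
  have hα1' : 1 - α = c * dnr d prm.nr / (1 + c * dnr d prm.nr) := by
    rw [hα]; field_simp; ring
  have hα1 : 0 ≤ 1 - α := by rw [hα1']; positivity
  have hμc : d * (L * prm.μc) ^ 2 ≤ σ ^ 2 := by
    have h0 : 0 ≤ L * prm.μc * √(d : ℝ) := mul_nonneg (mul_nonneg hL hS.μc_pos.le) (by positivity)
    have h := pow_le_pow_left₀ h0 hS.μc_le 2
    rw [mul_pow, Real.sq_sqrt (by positivity)] at h
    linarith
  set v : Ω → Vec d := fun ω => X.x t ω - y with hv
  have hvm : Measurable v := (hS.measurable_x ht.le).sub_const y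
  have hv2 : Integrable (fun ω => ‖v ω‖ ^ 2) P := hS.integrable_norm_sub_sq ht.le y
  have hgRm : Measurable (X.gradR F t) := measurable_batchMean fun j => hS.measurable_rge ht j
  have hgCm : Measurable (X.gradC F t) := measurable_batchMean fun j => hS.measurable_cge ht j
  obtain ⟨hR1, hR2⟩ : Integrable (fun ω => ‖X.gradR F t ω‖ ^ 2) P ∧ _ :=
    integral_norm_batchMean_sq_le (hS.br_pos t ht) (fun j => hS.measurable_rge ht j)
      fun j => hS.integral_norm_rge_sq_le hL ht j
  obtain ⟨hC1, hC2⟩ : Integrable (fun ω => ‖X.gradC F t ω‖ ^ 2) P ∧ _ :=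
    integral_norm_batchMean_sq_le (hS.bc_pos t ht) (fun j => hS.measurable_cge ht j)
      fun j => hS.integral_norm_cge_sq_le hL ht j
  have hRi : Integrable (fun ω => inner ℝ (v ω) (X.gradR F t ω)) P :=
    integrable_inner_of_sq hvm hgRm hv2 hR1
  have hCi : Integrable (fun ω => inner ℝ (v ω) (X.gradC F t ω)) P :=
    integrable_inner_of_sq hvm hgCm hv2 hC1
  have hRl : ∫ ω, φ (X.x t ω) ∂P ≤ ∫ ω, inner ℝ (v ω) (X.gradR F t ω) ∂P :=
    le_integral_inner_batchMean (hS.br_pos t ht)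
      (fun j => integrable_inner_of_sq hvm (hS.measurable_rge ht j) hv2
        (hS.integral_norm_rge_sq_le hL ht j).1)
      fun j => hS.le_integral_inner_rge hL ht j y hBr hφ hle
  have hCl : ∫ ω, φ (X.x t ω) ∂P ≤ ∫ ω, inner ℝ (v ω) (X.gradC F t ω) ∂P :=
    le_integral_inner_batchMean (hS.bc_pos t ht)
      (fun j => integrable_inner_of_sq hvm (hS.measurable_cge ht j) hv2
        (hS.integral_norm_cge_sq_le hL ht j).1)
      fun j => hS.le_integral_inner_cge hL ht j y hBc hφ hle
  have hpt : ∀ ω, ‖X.x (t + 1) ω - y‖ ^ 2 ≤ ‖v ω‖ ^ 2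
      - 2 * η * (α * inner ℝ (v ω) (X.gradR F t ω) + (1 - α) * inner ℝ (v ω) (X.gradC F t ω))
      + η ^ 2 * (α * ‖X.gradR F t ω‖ ^ 2 + (1 - α) * ‖X.gradC F t ω‖ ^ 2) := by
    intro ω
    set gR := X.gradR F t ω
    set gC := X.gradC F t ω
    have e : X.x (t + 1) ω - y = v ω - η • (α • gR + (1 - α) • gC) := by
      rw [hr.step t ht ω]; simp only [hv]; abel
    have hconv : ‖α • gR + (1 - α) • gC‖ ^ 2 ≤ α * ‖gR‖ ^ 2 + (1 - α) * ‖gC‖ ^ 2 := by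
      have h1 : ‖α • gR + (1 - α) • gC‖ ≤ α * ‖gR‖ + (1 - α) * ‖gC‖ := by
        refine (norm_add_le _ _).trans ?_
        rw [norm_smul, norm_smul, Real.norm_of_nonneg hα0, Real.norm_of_nonneg hα1]
      refine (pow_le_pow_left₀ (norm_nonneg _) h1 2).trans ?_
      nlinarith [mul_nonneg (mul_nonneg hα0 hα1) (sq_nonneg (‖gR‖ - ‖gC‖))]
    rw [e, norm_sub_sq_real, inner_smul_right, inner_add_right, inner_smul_right, inner_smul_right,
      norm_smul, mul_pow, Real.norm_eq_abs, sq_abs]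
    have := mul_le_mul_of_nonneg_left hconv (sq_nonneg η)
    linarith
  have hI1 : Integrable (fun ω => α * inner ℝ (v ω) (X.gradR F t ω)
      + (1 - α) * inner ℝ (v ω) (X.gradC F t ω)) P := (hRi.const_mul α).add (hCi.const_mul _)
  have hI2 : Integrable (fun ω => α * ‖X.gradR F t ω‖ ^ 2 + (1 - α) * ‖X.gradC F t ω‖ ^ 2) P :=
    (hR1.const_mul α).add (hC1.const_mul _)
  have hI3 : Integrable (fun ω => ‖v ω‖ ^ 2
      - 2 * η * (α * inner ℝ (v ω) (X.gradR F t ω) + (1 - α) * inner ℝ (v ω) (X.gradC F t ω))) P :=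
    hv2.sub (hI1.const_mul _)
  have hmain := integral_mono (hS.integrable_norm_sub_sq (t := t + 1) ht y)
    (hI3.add (hI2.const_mul (η ^ 2))) hpt
  simp only [Pi.add_apply] at hmain
  rw [integral_add hI3 (hI2.const_mul (η ^ 2)), integral_sub hv2 (hI1.const_mul _),
    integral_const_mul, integral_const_mul, integral_add (hRi.const_mul α) (hCi.const_mul _),
    integral_add (hR1.const_mul α) (hC1.const_mul _), integral_const_mul, integral_const_mul,
    integral_const_mul, integral_const_mul] at hmain
  have hA : ∫ ω, φ (X.x t ω) ∂P ≤ α * ∫ ω, inner ℝ (v ω) (X.gradR F t ω) ∂P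
      + (1 - α) * ∫ ω, inner ℝ (v ω) (X.gradC F t ω) ∂P := by
    have h1 := mul_le_mul_of_nonneg_left hRl hα0
    have h2 := mul_le_mul_of_nonneg_left hCl hα1
    linarith
  have hV : α * ∫ ω, ‖X.gradR F t ω‖ ^ 2 ∂P + (1 - α) * ∫ ω, ‖X.gradC F t ω‖ ^ 2 ∂P
      ≤ effDim d prm.nr c * (8 * G ^ 2 + 18 * σ ^ 2) := by
    have h1 : ∫ ω, ‖X.gradR F t ω‖ ^ 2 ∂P ≤ dnr d prm.nr * (4 * G ^ 2 + 12 * σ ^ 2) :=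
      hR2.trans (mul_le_mul_of_nonneg_left (by linarith) (by linarith))
    have h2 : ∫ ω, ‖X.gradC F t ω‖ ^ 2 ∂P ≤ (4 * G ^ 2 + 6 * σ ^ 2) / c :=
      hC2.trans (div_le_div_of_nonneg_right (by linarith) hc.le)
    calc _ ≤ α * (dnr d prm.nr * (4 * G ^ 2 + 12 * σ ^ 2))
          + (1 - α) * ((4 * G ^ 2 + 6 * σ ^ 2) / c) := by gcongr
      _ = _ := by
        rw [hα1', hα, effDim]
        field_simp
        ring
  have h1 := mul_le_mul_of_nonneg_left hA (by positivity : 0 ≤ 2 * η)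
  have h2 := mul_le_mul_of_nonneg_left hV (sq_nonneg η)
  linarith

/-! ### Consequences of the standing assumptions -/

omit [IsProbabilityMeasure P] in
theorem Setting.exists_eq_optValue (hS : Setting P ν F K L R G σ c prm T X) (hL : 0 ≤ L) :
    ∃ y ∈ K, objective ν F y = optValue (objective ν F) K := by
  obtain ⟨x₀, hx₀, -⟩ := hS.run
  obtain ⟨y, hy, h⟩ := hS.convex.isCompact.exists_sInf_image_eq ⟨x₀, hx₀⟩
    (hS.smooth.continuous_objective hL).continuousOn
  exact ⟨y, hy, h.symm⟩

omit [IsProbabilityMeasure P] [IsProbabilityMeasure ν] in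
theorem Setting.R_nonneg (hS : Setting P ν F K L R G σ c prm T X) : 0 ≤ R := by
  obtain ⟨x₀, hx₀, -⟩ := hS.run
  simpa using hS.convex.diam x₀ hx₀ x₀ hx₀

omit [IsProbabilityMeasure P] [IsProbabilityMeasure ν] in
theorem Setting.G_nonneg (hS : Setting P ν F K L R G σ c prm T X) : 0 ≤ G := by
  obtain ⟨x₀, hx₀, -⟩ := hS.run
  exact (norm_nonneg _).trans (hS.boundedGradient x₀ hx₀)

omit [IsProbabilityMeasure ν] in
theorem Setting.integral_norm_sub_sq_le (hS : Setting P ν F K L R G σ c prm T X) {t : ℕ}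
    (ht : t ≤ T) {y : Vec d} (hy : y ∈ K) : ∫ ω, ‖X.x t ω - y‖ ^ 2 ∂P ≤ R ^ 2 := by
  have h := integral_mono_ae (hS.integrable_norm_sub_sq ht y) (integrable_const (R ^ 2)) (by
    filter_upwards [hS.mem_domain t ht] with ω hω
    exact pow_le_pow_left₀ (norm_nonneg _) (hS.convex.diam y hy _ hω) 2)
  simpa using h

theorem Setting.integrable_objective (hS : Setting P ν F K L R G σ c prm T X) (hL : 0 ≤ L) {t : ℕ}
    (ht : t ≤ T) : Integrable (fun ω => objective ν F (X.x t ω)) P :=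
  hS.integrable_comp_x ht (hS.smooth.continuous_objective hL)

omit [IsProbabilityMeasure ν] in
theorem Setting.effDim_pos (hS : Setting P ν F K L R G σ c prm T X) : 0 < effDim d prm.nr c :=
  one_half_pos.trans_le (half_le_effDim d prm.nr hS.c_pos hS.c_le_one)

/-- The values of the objective at two iterates differ by at most `G R`. -/
theorem Setting.integral_objective_sub_le (hS : Setting P ν F K L R G σ c prm T X) (hL : 0 ≤ L)
    {s t : ℕ} (hs : s ≤ T) (ht : t ≤ T) :
    ∫ ω, objective ν F (X.x t ω) ∂P ≤ ∫ ω, objective ν F (X.x s ω) ∂P + G * R := by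
  have h := integral_mono_ae (hS.integrable_objective hL ht)
    ((hS.integrable_objective hL hs).add (integrable_const (G * R))) (by
    filter_upwards [hS.mem_domain t ht, hS.mem_domain s hs] with ω h1 h2
    have h3 := hS.convex.le _ h1 _ h2
    have h4 := neg_le_of_abs_le (abs_real_inner_le_norm (gradient (objective ν F) (X.x t ω))
      (X.x s ω - X.x t ω))
    have h5 : ‖gradient (objective ν F) (X.x t ω)‖ * ‖X.x s ω - X.x t ω‖ ≤ G * R :=
      mul_le_mul (hS.boundedGradient _ h1) (hS.convex.diam _ h1 _ h2) (norm_nonneg _) hS.G_nonneg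
    simp only [Pi.add_apply]
    linarith)
  simp only [Pi.add_apply] at h
  rw [integral_add (hS.integrable_objective hL hs) (integrable_const _)] at h
  simpa using h

omit [IsProbabilityMeasure ν] in
/-- The upper bound on `μ_c` in terms of the rate `√(D / T)` for the effective dimension `D`. -/
theorem Setting.μc_mul_sqrt_le (hS : Setting P ν F K L R G σ c prm T X) {M : ℝ}
    (hM : prm.μc ≤ M * √(1 / ((d : ℝ) * T) * effDim d prm.nr c)) :
    prm.μc * √(d : ℝ) ≤ M * √(1 / (T : ℝ) * effDim d prm.nr c) := by
  have hd : (0 : ℝ) < d := by exact_mod_cast hS.d_pos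
  have hT : (0 : ℝ) < T := by exact_mod_cast hS.T_pos
  calc prm.μc * √(d : ℝ) ≤ M * √(1 / ((d : ℝ) * T) * effDim d prm.nr c) * √(d : ℝ) := by gcongr
    _ = _ := by
      rw [mul_assoc, ← Real.sqrt_mul (mul_nonneg (by positivity) hS.effDim_pos.le)]
      congr 2
      field_simp

/-! ### The convex case -/

/-- The recursion of the convex case with a constant step size `η`. -/
theorem sum_le_of_step {r e : ℕ → ℝ} {η A W : ℝ} {T : ℕ} (hη : 0 < η) (hrT : 0 ≤ r T)
    (hstep : ∀ t < T, r (t + 1) ≤ r t - 2 * η * (e t - A) + η ^ 2 * W) :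
    ∑ t ∈ Finset.range T, e t ≤ r 0 / (2 * η) + T * (A + η * W / 2) := by
  have h1 : ∑ t ∈ Finset.range T, 2 * η * e t
      ≤ ∑ t ∈ Finset.range T, ((r t - r (t + 1)) + (2 * η * A + η ^ 2 * W)) :=
    Finset.sum_le_sum fun t ht => by
      have := hstep t (Finset.mem_range.1 ht)
      linarith
  rw [Finset.sum_add_distrib, Finset.sum_range_sub', ← Finset.mul_sum, Finset.sum_const,
    Finset.card_range, nsmul_eq_mul] at h1
  have h2 : 2 * η * (r 0 / (2 * η) + T * (A + η * W / 2))
      = r 0 + T * (2 * η * A + η ^ 2 * W) := by field_simp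
  refine le_of_mul_le_mul_left ?_ (by positivity : 0 < 2 * η)
  linarith

/-- Evaluation of the bound for the convex case with `Q = √(D / T)`, for which the step size is
`η = κ / (T Q)`, and with `H = G R`. -/
theorem convex_rate_arith {T Q κ η D B L M R V H : ℝ} (hT : 0 < T) (hκ : 0 < κ)
    (hH : 0 ≤ H) (hη : η = κ / (T * Q)) (hD : D = T * Q ^ 2) (hB : B = 2 * L * M * Q)
    (hTQ : 1 / T ≤ 2 * Q) :
    (1 / T) * (R ^ 2 / (2 * η) + T * (B * R + η * (D * V) / 2) + H)
      ≤ (R ^ 2 / (2 * κ) + 2 * L * M * R + κ * V / 2 + 2 * H) * Q := by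
  have e : (1 / T) * (R ^ 2 / (2 * η) + T * (B * R + η * (D * V) / 2) + H)
      = R ^ 2 / (2 * κ) * Q + (2 * L * M * R) * Q + κ * V / 2 * Q + 1 / T * H := by
    rw [hD, hη, hB]
    field_simp
    ring
  have := mul_le_mul_of_nonneg_right hTQ hH
  rw [e]
  linarith

theorem Setting.convex_step (hS : Setting P ν F K L R G σ c prm T X) (hL : 0 ≤ L)
    (hμr : d * (L * prm.μr) ^ 2 ≤ 4 * σ ^ 2) {t : ℕ} (ht : t < T)
    (hα : prm.α t = 1 / (1 + c * dnr d prm.nr)) (hη : 0 ≤ prm.η t) {y : Vec d} (hy : y ∈ K) {B : ℝ}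
    (hBr : L * prm.μr ≤ B) (hBc : L * prm.μc * √(d : ℝ) ≤ B) :
    ∫ ω, ‖X.x (t + 1) ω - y‖ ^ 2 ∂P ≤ ∫ ω, ‖X.x t ω - y‖ ^ 2 ∂P
      - 2 * prm.η t * ((∫ ω, objective ν F (X.x t ω) ∂P - objective ν F y) - B * R)
      + prm.η t ^ 2 * (effDim d prm.nr c * (8 * G ^ 2 + 18 * σ ^ 2)) := by
  have hB0 : 0 ≤ B := (mul_nonneg hL hS.μr_pos.le).trans hBr
  have h := hS.integral_norm_sub_sq_succ_le hL hμr ht hα hη y hBr hBc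
    (φ := fun x => objective ν F x - objective ν F y - B * R)
    (((hS.smooth.continuous_objective hL).sub continuous_const).sub continuous_const)
    (by
      intro x hx
      have h1 := hS.convex.le x hx y hy
      have h2 := mul_le_mul_of_nonneg_left (hS.convex.diam y hy x hx) hB0
      rw [← neg_sub x y, inner_neg_right, real_inner_comm] at h1
      linarith)
  have hi := hS.integrable_objective hL ht.le
  have hi1 : Integrable (fun ω => objective ν F (X.x t ω) - objective ν F y) P :=
    hi.sub (integrable_const _)
  rw [integral_sub hi1 (integrable_const _), integral_sub hi (integrable_const _)] at h
  simpa using h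

/-- The iterates `x_1, …, x_T` are averaged in the convex case, while the recursion bounds the sum
over `x_0, …, x_{T-1}`. -/
theorem Setting.sum_Icc_integral_objective_sub_le (hS : Setting P ν F K L R G σ c prm T X)
    (hL : 0 ≤ L) (m : ℝ) :
    ∑ t ∈ Finset.Icc 1 T, (∫ ω, objective ν F (X.x t ω) ∂P - m)
      ≤ ∑ t ∈ Finset.range T, (∫ ω, objective ν F (X.x t ω) ∂P - m) + G * R := by
  set e : ℕ → ℝ := fun t => ∫ ω, objective ν F (X.x t ω) ∂P - m with he
  have h1 : ∑ t ∈ Finset.Icc 1 T, e t = ∑ t ∈ Finset.range T, e (t + 1) := by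
    rw [← Finset.Ico_add_one_right_eq_Icc, Finset.sum_Ico_eq_sum_range]
    simp [add_comm]
  have h2 := Finset.sum_range_succ e T
  have h3 := Finset.sum_range_succ' e T
  have h4 : e T ≤ e 0 + G * R := by
    have := hS.integral_objective_sub_le hL (Nat.zero_le T) le_rfl
    simp only [he]
    linarith
  linarith

theorem Setting.convex_rate (hS : Setting P ν F K L R G σ c prm T X) (hL : 0 ≤ L) {M κ : ℝ}
    (hκ : 0 < κ) (hμ : prm.μc = prm.μr * √(d : ℝ) / 2)
    (hM : prm.μc ≤ M * √(1 / ((d : ℝ) * T) * effDim d prm.nr c))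
    (hη : ∀ t < T, prm.η t = κ / √((T : ℝ) * effDim d prm.nr c))
    (hα : ∀ t < T, prm.α t = 1 / (1 + c * dnr d prm.nr)) :
    ((1 / (T : ℝ)) * ∑ t ∈ Finset.Icc 1 T, (∫ ω, objective ν F (X.x t ω) ∂P))
        - optValue (objective ν F) K
      ≤ (R ^ 2 / (2 * κ) + 2 * L * M * R + κ * (8 * G ^ 2 + 18 * σ ^ 2) / 2 + 2 * (G * R))
        * √(1 / (T : ℝ) * effDim d prm.nr c) := by
  obtain ⟨y, hy, hyopt⟩ := hS.exists_eq_optValue hL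
  have hd : (1 : ℝ) ≤ d := by exact_mod_cast hS.d_pos
  have hT : (1 : ℝ) ≤ T := by exact_mod_cast hS.T_pos
  have hD := hS.effDim_pos
  have hD2 := half_le_effDim d prm.nr hS.c_pos hS.c_le_one
  have hR := hS.R_nonneg
  have hG := hS.G_nonneg
  set D := effDim d prm.nr c with hDdef
  set Q := √(1 / (T : ℝ) * D) with hQdef
  set V := 8 * G ^ 2 + 18 * σ ^ 2 with hVdef
  have hQ : 0 < Q := by rw [hQdef]; positivity
  have hQ2 : Q ^ 2 = 1 / (T : ℝ) * D := Real.sq_sqrt (by positivity)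
  have hTD : √((T : ℝ) * D) = T * Q := by
    rw [Real.sqrt_eq_iff_mul_self_eq (by positivity) (by positivity)]
    calc T * D = T ^ 2 * (1 / (T : ℝ) * D) := by field_simp
      _ = (T * Q) * (T * Q) := by rw [← hQ2]; ring
  have hDQ : D = T * Q ^ 2 := by rw [hQ2, one_div, mul_inv_cancel_left₀ (by positivity)]
  have hsqd : 1 ≤ √(d : ℝ) := Real.one_le_sqrt.2 hd
  have hμc := mul_le_mul_of_nonneg_left (hS.μc_mul_sqrt_le hM) hL
  have hLμ : 0 ≤ L * (prm.μc * √(d : ℝ)) := mul_nonneg hL (mul_nonneg hS.μc_pos.le (by positivity))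
  -- `μ_r = 2 μ_c / √d ≤ 2 μ_c √d`
  have hμr : L * prm.μr ≤ 2 * (L * (prm.μc * √(d : ℝ))) := by
    have : prm.μr ≤ 2 * (prm.μc * √(d : ℝ)) := by
      rw [hμ]
      nlinarith [hS.μr_pos, mul_le_mul hsqd hsqd zero_le_one (by positivity)]
    nlinarith
  have hμr2 : d * (L * prm.μr) ^ 2 ≤ 4 * σ ^ 2 := by
    have h1 : d * (L * prm.μr) ^ 2 = 4 * (L * prm.μc) ^ 2 := by
      rw [hμ]
      have := Real.sq_sqrt (by positivity : (0 : ℝ) ≤ d)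
      linear_combination (-(L * prm.μr) ^ 2) * this
    have h2 : L * prm.μc ≤ σ :=
      (le_mul_of_one_le_right (mul_nonneg hL hS.μc_pos.le) hsqd).trans hS.μc_le
    have h3 := pow_le_pow_left₀ (mul_nonneg hL hS.μc_pos.le) h2 2
    linarith
  set B := 2 * L * M * Q with hB
  have hBr : L * prm.μr ≤ B := by rw [hB]; linarith
  have hBc : L * prm.μc * √(d : ℝ) ≤ B := by rw [hB]; linarith
  have hB0 : 0 ≤ B := by linarith
  set η := κ / (T * Q) with hηdef
  have hη0 : 0 < η := by rw [hηdef]; positivity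
  set e : ℕ → ℝ := fun t => ∫ ω, objective ν F (X.x t ω) ∂P - objective ν F y with he
  set r : ℕ → ℝ := fun t => ∫ ω, ‖X.x t ω - y‖ ^ 2 ∂P with hr
  have hstep : ∀ t < T, r (t + 1) ≤ r t - 2 * η * (e t - B * R) + η ^ 2 * (D * V) := by
    intro t ht
    have h := hS.convex_step hL hμr2 ht (hα t ht) (by rw [hη t ht, hTD]; exact hη0.le) hy hBr hBc
    rwa [hη t ht, hTD] at h
  have hrT : 0 ≤ r T := integral_nonneg fun _ => sq_nonneg _
  have hsum := sum_le_of_step hη0 hrT hstep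
  have hr0 : r 0 ≤ R ^ 2 := hS.integral_norm_sub_sq_le (Nat.zero_le _) hy
  have hshift : ∑ t ∈ Finset.Icc 1 T, e t ≤ ∑ t ∈ Finset.range T, e t + G * R :=
    hS.sum_Icc_integral_objective_sub_le hL _
  have hlhs : ((1 / (T : ℝ)) * ∑ t ∈ Finset.Icc 1 T, (∫ ω, objective ν F (X.x t ω) ∂P))
      - optValue (objective ν F) K
      = (1 / (T : ℝ)) * ∑ t ∈ Finset.Icc 1 T, e t := by
    simp only [he, Finset.sum_sub_distrib, ← hyopt]
    simp
    field_simp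
  -- `D ≥ 1 / 2` and `T ≥ 1`
  have hTQ : 1 / (T : ℝ) ≤ 2 * Q := by
    refine (sq_le_sq₀ (by positivity) (by positivity)).1 ?_
    rw [mul_pow, hQ2, one_div, inv_pow]
    have h1 : ((T : ℝ) ^ 2)⁻¹ ≤ (T : ℝ)⁻¹ :=
      inv_anti₀ (by positivity) (le_self_pow₀ hT two_ne_zero)
    have h2 : 0 < (T : ℝ)⁻¹ := by positivity
    nlinarith
  rw [hlhs]
  have h0 : r 0 / (2 * η) ≤ R ^ 2 / (2 * η) := by gcongr
  calc (1 / (T : ℝ)) * ∑ t ∈ Finset.Icc 1 T, e t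
      ≤ (1 / (T : ℝ)) * (R ^ 2 / (2 * η) + T * (B * R + η * (D * V) / 2) + G * R) := by
        gcongr; linarith
    _ ≤ _ := convex_rate_arith (by positivity) hκ (mul_nonneg hG hR) hηdef hDQ hB hTQ

/-! ### The strongly convex case -/

/-- The weights satisfy `∑ (a + t) ≤ (2 / T) ∑ (a + t) ^ 2`, which gives the rate `1 / T` for the
noise terms; this is Cauchy–Schwarz together with `∑ (a + t) ≥ T ^ 2 / 2`. -/
theorem mul_sum_add_le_two_mul_sum_sq {a : ℝ} (ha : 1 ≤ a) (T : ℕ) :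
    T * ∑ t ∈ Finset.range T, (a + (t : ℝ)) ≤ 2 * ∑ t ∈ Finset.range T, (a + (t : ℝ)) ^ 2 := by
  have h1 : (T : ℝ) ^ 2 / 2 ≤ ∑ t ∈ Finset.range T, (a + (t : ℝ)) := by
    induction T with
    | zero => simp
    | succ n ih =>
      rw [Finset.sum_range_succ]
      push_cast
      nlinarith
  have h2 := sq_sum_le_card_mul_sum_sq (s := Finset.range T) (f := fun t => a + (t : ℝ))
  rw [Finset.card_range] at h2
  rcases Nat.eq_zero_or_pos T with rfl | hT
  · simp
  have hT' : (0 : ℝ) < T := by exact_mod_cast hT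
  have h3 : 0 ≤ ∑ t ∈ Finset.range T, (a + (t : ℝ)) :=
    (by positivity : (0 : ℝ) ≤ T ^ 2 / 2).trans h1
  have h4 := mul_le_mul_of_nonneg_right h1 h3
  have h5 : T * (T * ∑ t ∈ Finset.range T, (a + (t : ℝ)))
      ≤ T * (2 * ∑ t ∈ Finset.range T, (a + (t : ℝ)) ^ 2) := by linarith
  exact le_of_mul_le_mul_left h5 hT'

theorem le_sum_add_sq {a : ℝ} (ha : 1 ≤ a) (T : ℕ) :
    (T : ℝ) ≤ ∑ t ∈ Finset.range T, (a + (t : ℝ)) ^ 2 := by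
  have h : ∑ _t ∈ Finset.range T, (1 : ℝ) ≤ ∑ t ∈ Finset.range T, (a + (t : ℝ)) ^ 2 :=
    Finset.sum_le_sum fun t _ => one_le_pow₀ (by have : (0 : ℝ) ≤ t := t.cast_nonneg; linarith)
  simpa using h

/-- The recursion of the strongly convex case with the step sizes `η_t = 8 / (s (a + t))`.
Multiplication by `w_t / (2 η_t)` makes the distances `r_t` telescope, since
`w³ - 4 w² ≤ (w - 1)³` for `w = a + t ≥ 1`. -/
theorem sum_sq_mul_le_of_step {r e : ℕ → ℝ} {s a b W : ℝ} {T : ℕ} (hs : 0 < s) (ha : 1 < a)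
    (hT : 1 ≤ T) (hW : 0 ≤ W) (hr0 : ∀ t, 0 ≤ r t)
    (hstep : ∀ t < T, r (t + 1) ≤ r t
      - 2 * (8 / (s * (a + (t : ℝ)))) * (e t + s / 4 * r t - b)
      + (8 / (s * (a + (t : ℝ)))) ^ 2 * W) :
    ∑ t ∈ Finset.range T, (a + (t : ℝ)) ^ 2 * e t ≤ s / 16 * (a - 1) ^ 3 * r 0
      + (∑ t ∈ Finset.range T, (a + (t : ℝ)) ^ 2) * b
      + (2 * (∑ t ∈ Finset.range T, (a + (t : ℝ)) ^ 2) / T) * (4 * W / s) := by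
  have hstep2 : ∀ t < T, (a + (t : ℝ)) ^ 2 * e t
      ≤ (s / 16 * (a + (t : ℝ) - 1) ^ 3 * r t
          - s / 16 * (a + ((t + 1 : ℕ) : ℝ) - 1) ^ 3 * r (t + 1))
        + ((a + (t : ℝ)) ^ 2 * b + (a + (t : ℝ)) * (4 * W / s)) := by
    intro t ht
    have ht0 : (0 : ℝ) ≤ t := t.cast_nonneg
    have h0 := hstep t ht
    push_cast
    rw [show a + ((t : ℝ) + 1) - 1 = a + t by ring]
    set w := a + (t : ℝ) with hw
    have hw1 : 1 ≤ w := by linarith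
    have h := mul_le_mul_of_nonneg_left h0 (by positivity : 0 ≤ s / 16 * w ^ 3)
    have e1 : s / 16 * w ^ 3 * (r t - 2 * (8 / (s * w)) * (e t + s / 4 * r t - b)
        + (8 / (s * w)) ^ 2 * W)
        = s / 16 * (w ^ 3 - 4 * w ^ 2) * r t - w ^ 2 * e t + w ^ 2 * b + w * (4 * W / s) := by
      field_simp
      ring
    have e2 : s / 16 * (w ^ 3 - 4 * w ^ 2) * r t ≤ s / 16 * (w - 1) ^ 3 * r t := by
      have e3 : w ^ 3 - 4 * w ^ 2 ≤ (w - 1) ^ 3 := by nlinarith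
      exact mul_le_mul_of_nonneg_right (mul_le_mul_of_nonneg_left e3 (by positivity)) (hr0 t)
    rw [e1] at h
    linarith
  have hT' : (1 : ℝ) ≤ T := by exact_mod_cast hT
  have h1 := Finset.sum_le_sum fun t (ht : t ∈ Finset.range T) => hstep2 t (Finset.mem_range.1 ht)
  rw [Finset.sum_add_distrib, Finset.sum_range_sub' (fun t : ℕ =>
    s / 16 * (a + (t : ℝ) - 1) ^ 3 * r t), Finset.sum_add_distrib, ← Finset.sum_mul,
    ← Finset.sum_mul, Nat.cast_zero, add_zero] at h1
  have h2 : ∑ t ∈ Finset.range T, (a + (t : ℝ))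
      ≤ 2 * (∑ t ∈ Finset.range T, (a + (t : ℝ)) ^ 2) / T := by
    rw [le_div_iff₀ (by positivity), mul_comm]
    exact mul_sum_add_le_two_mul_sum_sq ha.le T
  have h3 : 0 ≤ s / 16 * (a + (T : ℝ) - 1) ^ 3 * r T := by
    have h4 : 0 ≤ a + (T : ℝ) - 1 := by linarith
    exact mul_nonneg (by positivity) (hr0 T)
  have h6 := mul_le_mul_of_nonneg_right h2 (by positivity : 0 ≤ 4 * W / s)
  linarith

omit [IsProbabilityMeasure P] [IsProbabilityMeasure ν] in
/-- The weighted average lies in the domain, and Jensen's inequality holds for it. -/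
theorem Setting.weightedAverage_mem_and_le (hS : Setting P ν F K L R G σ c prm T X) {a : ℝ}
    (ha : 1 < a) : ∀ᵐ ω ∂P, weightedAverage X a T ω ∈ K ∧
      objective ν F (weightedAverage X a T ω) ≤ (1 / ∑ t ∈ Finset.range T, (a + (t : ℝ)) ^ 2) *
        ∑ t ∈ Finset.range T, (a + (t : ℝ)) ^ 2 * objective ν F (X.x t ω) := by
  have hT : (1 : ℝ) ≤ T := by exact_mod_cast hS.T_pos
  have hall : ∀ᵐ ω ∂P, ∀ t ∈ Finset.range T, X.x t ω ∈ K :=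
    (Finset.eventually_all _).2 fun t ht => hS.mem_domain t (Finset.mem_range.1 ht).le
  filter_upwards [hall] with ω hω
  set S := ∑ t ∈ Finset.range T, (a + (t : ℝ)) ^ 2 with hSdef
  have hS0 : 0 < S := by linarith [le_sum_add_sq ha.le T]
  set z := weightedAverage X a T ω with hz
  have hz' : S • z = ∑ t ∈ Finset.range T, (a + (t : ℝ)) ^ 2 • X.x t ω := by
    rw [hz, weightedAverage, smul_smul, mul_one_div_cancel hS0.ne', one_smul]
  have hzK : z ∈ K := by
    rw [hz, weightedAverage, Finset.smul_sum]
    simp only [smul_smul]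
    refine hS.convex.convex.sum_mem (fun t _ => by positivity) ?_ hω
    rw [← Finset.mul_sum, one_div_mul_cancel hS0.ne']
  refine ⟨hzK, ?_⟩
  -- the gradient inequality at the average itself
  have h1 : ∑ t ∈ Finset.range T, (a + (t : ℝ)) ^ 2 * (objective ν F z
      + inner ℝ (gradient (objective ν F) z) (X.x t ω - z))
      ≤ ∑ t ∈ Finset.range T, (a + (t : ℝ)) ^ 2 * objective ν F (X.x t ω) := by
    gcongr with t ht
    exact hS.convex.le z hzK _ (hω t ht)
  have h2 : ∑ t ∈ Finset.range T, (a + (t : ℝ)) ^ 2 *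
      inner ℝ (gradient (objective ν F) z) (X.x t ω - z) = 0 := by
    simp only [← inner_smul_right]
    rw [← inner_sum]
    simp only [smul_sub]
    rw [Finset.sum_sub_distrib, ← Finset.sum_smul, ← hz', sub_self, inner_zero_right]
  simp only [mul_add] at h1
  rw [Finset.sum_add_distrib, h2, add_zero, ← Finset.sum_mul, ← hSdef] at h1
  rw [one_div, inv_mul_eq_div, le_div_iff₀ hS0]
  linarith

theorem Setting.integrable_objective_weightedAverage (hS : Setting P ν F K L R G σ c prm T X)
    (hL : 0 ≤ L) {a : ℝ} (ha : 1 < a) :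
    Integrable (fun ω => objective ν F (weightedAverage X a T ω)) P := by
  have hcont := hS.smooth.continuous_objective hL
  obtain ⟨C, hC⟩ := hS.convex.isCompact.exists_bound_of_continuousOn hcont.continuousOn
  have hsum : Measurable fun ω => ∑ t ∈ Finset.range T, (a + (t : ℝ)) ^ 2 • X.x t ω :=
    Finset.measurable_sum _ fun t ht =>
      (hS.measurable_x (Finset.mem_range.1 ht).le).const_smul ((a + (t : ℝ)) ^ 2)
  have hm : Measurable (weightedAverage X a T) :=
    hsum.const_smul (1 / ∑ t ∈ Finset.range T, (a + (t : ℝ)) ^ 2)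
  refine Integrable.of_bound (hcont.measurable.comp hm).aestronglyMeasurable C ?_
  filter_upwards [hS.weightedAverage_mem_and_le ha] with ω hω using hC _ hω.1

theorem Setting.integral_objective_weightedAverage_sub_le
    (hS : Setting P ν F K L R G σ c prm T X) (hL : 0 ≤ L) {a : ℝ} (ha : 1 < a) (m : ℝ) :
    (∫ ω, objective ν F (weightedAverage X a T ω) ∂P) - m
      ≤ 1 / (∑ t ∈ Finset.range T, (a + (t : ℝ)) ^ 2) * ∑ t ∈ Finset.range T,
        (a + (t : ℝ)) ^ 2 * (∫ ω, objective ν F (X.x t ω) ∂P - m) := by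
  have hT : (1 : ℝ) ≤ T := by exact_mod_cast hS.T_pos
  have hi : ∀ t ∈ Finset.range T,
      Integrable (fun ω => (a + (t : ℝ)) ^ 2 * objective ν F (X.x t ω)) P :=
    fun t ht => (hS.integrable_objective hL (Finset.mem_range.1 ht).le).const_mul _
  have h1 := integral_mono_ae (hS.integrable_objective_weightedAverage hL ha)
    ((integrable_finsetSum _ hi).const_mul _)
    ((hS.weightedAverage_mem_and_le ha).mono fun ω hω => hω.2)
  have hTS := le_sum_add_sq ha.le T
  rw [integral_const_mul, integral_finsetSum _ hi] at h1
  simp only [integral_const_mul] at h1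
  set S := ∑ t ∈ Finset.range T, (a + (t : ℝ)) ^ 2 with hSdef
  have hS0 : 0 < S := by linarith
  simp only [mul_sub, Finset.sum_sub_distrib, ← Finset.sum_mul, ← hSdef]
  rw [← mul_assoc, one_div_mul_cancel hS0.ne', one_mul]
  linarith

/-- Evaluation of the bound for the strongly convex case, where `S` is the sum of the weights and
`E` the weighted sum of the errors. -/
theorem stronglyConvex_rate_arith {s a T S D B H V R r₀ E : ℝ} (hs : 0 < s) (ha : 1 ≤ a)
    (hT : 0 < T) (hS : 0 < S) (hr : 0 ≤ r₀) (hrR : r₀ ≤ R ^ 2)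
    (hB : B ^ 2 = H * (1 / T * D)) (hTS : 1 / S ≤ 2 * (1 / T * D))
    (hE : E ≤ s / 16 * (a - 1) ^ 3 * r₀ + S * (B ^ 2 / s) + 2 * S / T * (4 * (D * V) / s)) :
    1 / S * E ≤ (s / 8 * (a - 1) ^ 3 * R ^ 2 + H / s + 8 * V / s) * (1 / T * D) := by
  have ha1 : 0 ≤ a - 1 := by linarith
  have h1 : s / 16 * (a - 1) ^ 3 * r₀ ≤ s / 16 * (a - 1) ^ 3 * R ^ 2 := by gcongr
  have h2 : 0 ≤ s / 16 * (a - 1) ^ 3 * r₀ := by positivity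
  calc 1 / S * E ≤ 1 / S * (s / 16 * (a - 1) ^ 3 * r₀ + S * (B ^ 2 / s)
          + 2 * S / T * (4 * (D * V) / s)) := by gcongr
    _ = 1 / S * (s / 16 * (a - 1) ^ 3 * r₀) + B ^ 2 / s + 8 * V / s * (1 / T * D) := by
        field_simp
        ring
    _ ≤ 2 * (1 / T * D) * (s / 16 * (a - 1) ^ 3 * R ^ 2) + B ^ 2 / s
          + 8 * V / s * (1 / T * D) := by
        have := mul_le_mul hTS h1 h2 ((one_div_pos.2 hS).le.trans hTS)
        linarith
    _ = _ := by rw [hB]; ring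

theorem Setting.stronglyConvex_step (hS : Setting P ν F K L R G σ c prm T X) (hL : 0 ≤ L) {s : ℝ}
    (hs : 0 < s) (hconv : StronglyConvexOnDomain (objective ν F) K s)
    (hμr : d * (L * prm.μr) ^ 2 ≤ 4 * σ ^ 2) {t : ℕ} (ht : t < T)
    (hα : prm.α t = 1 / (1 + c * dnr d prm.nr)) (hη : 0 ≤ prm.η t) {y : Vec d} (hy : y ∈ K) {B : ℝ}
    (hBr : L * prm.μr ≤ B) (hBc : L * prm.μc * √(d : ℝ) ≤ B) :
    ∫ ω, ‖X.x (t + 1) ω - y‖ ^ 2 ∂P ≤ ∫ ω, ‖X.x t ω - y‖ ^ 2 ∂P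
      - 2 * prm.η t * ((∫ ω, objective ν F (X.x t ω) ∂P - objective ν F y)
        + s / 4 * ∫ ω, ‖X.x t ω - y‖ ^ 2 ∂P - B ^ 2 / s)
      + prm.η t ^ 2 * (effDim d prm.nr c * (8 * G ^ 2 + 18 * σ ^ 2)) := by
  have h := hS.integral_norm_sub_sq_succ_le hL hμr ht hα hη y hBr hBc
    (φ := fun x => objective ν F x - objective ν F y + s / 4 * ‖x - y‖ ^ 2 - B ^ 2 / s)
    ((((hS.smooth.continuous_objective hL).sub continuous_const).add
      (by fun_prop)).sub continuous_const)
    (by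
      intro x hx
      have h1 := hconv x hx y hy
      rw [← neg_sub x y, inner_neg_right, real_inner_comm, norm_neg] at h1
      -- Young's inequality: half of the strong convexity pays for the bias
      have h2 : B * ‖x - y‖ ≤ B ^ 2 / s + s / 4 * ‖x - y‖ ^ 2 := by
        have : B ^ 2 / s + s / 4 * ‖x - y‖ ^ 2 - B * ‖x - y‖
            = (B - s / 2 * ‖x - y‖) ^ 2 / s := by field_simp; ring
        have := div_nonneg (sq_nonneg (B - s / 2 * ‖x - y‖)) hs.le
        linarith
      linarith)
  have hi := hS.integrable_objective hL ht.le
  have hi1 : Integrable (fun ω => objective ν F (X.x t ω) - objective ν F y) P :=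
    hi.sub (integrable_const _)
  have hi2 := (hS.integrable_norm_sub_sq ht.le y).const_mul (s / 4)
  have hi3 : Integrable (fun ω => objective ν F (X.x t ω) - objective ν F y
      + s / 4 * ‖X.x t ω - y‖ ^ 2) P := hi1.add hi2
  rw [integral_sub hi3 (integrable_const _), integral_add hi1 hi2,
    integral_sub hi (integrable_const _), integral_const_mul] at h
  simpa using h

theorem Setting.stronglyConvex_rate (hS : Setting P ν F K L R G σ c prm T X) (hL : 0 ≤ L)
    {M s a : ℝ} (hs : 0 < s) (ha : 1 < a)
    (hconv : StronglyConvexOnDomain (objective ν F) K s)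
    (hμ : prm.μr = prm.μc * √((d : ℝ) * L / s)) (hμσ : L * prm.μr * (d : ℝ) ≤ σ)
    (hM : prm.μc ≤ M * √(1 / ((d : ℝ) * T) * effDim d prm.nr c))
    (hη : ∀ t < T, prm.η t = 8 / (s * (a + (t : ℝ))))
    (hα : ∀ t < T, prm.α t = 1 / (1 + c * dnr d prm.nr)) :
    (∫ ω, objective ν F (weightedAverage X a T ω) ∂P) - optValue (objective ν F) K
      ≤ (s / 8 * (a - 1) ^ 3 * R ^ 2 + (L * M * (1 + √(L / s))) ^ 2 / s
          + 8 * (8 * G ^ 2 + 18 * σ ^ 2) / s) * (1 / (T : ℝ) * effDim d prm.nr c) := by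
  obtain ⟨y, hy, hyopt⟩ := hS.exists_eq_optValue hL
  have hd : (1 : ℝ) ≤ d := by exact_mod_cast hS.d_pos
  have hT : (1 : ℝ) ≤ T := by exact_mod_cast hS.T_pos
  have hD := hS.effDim_pos
  have hD2 := half_le_effDim d prm.nr hS.c_pos hS.c_le_one
  set D := effDim d prm.nr c with hDdef
  set Q := √(1 / (T : ℝ) * D) with hQdef
  set V := 8 * G ^ 2 + 18 * σ ^ 2 with hVdef
  have hV0 : 0 ≤ V := by positivity
  have hQ2 : Q ^ 2 = 1 / (T : ℝ) * D := Real.sq_sqrt (by positivity)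
  have hμc := mul_le_mul_of_nonneg_left (hS.μc_mul_sqrt_le hM) hL
  have hLμ : 0 ≤ L * (prm.μc * √(d : ℝ)) := mul_nonneg hL (mul_nonneg hS.μc_pos.le (by positivity))
  have hμr2 : d * (L * prm.μr) ^ 2 ≤ 4 * σ ^ 2 := by
    have h1 := pow_le_pow_left₀ (mul_nonneg (mul_nonneg hL hS.μr_pos.le) (by positivity)) hμσ 2
    nlinarith [sq_nonneg (L * prm.μr), sq_nonneg σ,
      mul_le_mul_of_nonneg_left hd (mul_nonneg (zero_le_one.trans hd) (sq_nonneg (L * prm.μr)))]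
  have hθ : 0 ≤ √(L / s) := Real.sqrt_nonneg _
  set B := L * M * (1 + √(L / s)) * Q with hB
  have hBc : L * prm.μc * √(d : ℝ) ≤ B := by
    rw [hB]
    nlinarith [mul_nonneg (hLμ.trans hμc) hθ]
  have hBr : L * prm.μr ≤ B := by
    rw [hμ, mul_div_assoc, Real.sqrt_mul (by positivity), hB]
    nlinarith [mul_le_mul_of_nonneg_right hμc hθ]
  have hB2 : B ^ 2 = (L * M * (1 + √(L / s))) ^ 2 * (1 / (T : ℝ) * D) := by
    rw [hB, mul_pow _ Q, hQ2]
  set e : ℕ → ℝ := fun t => ∫ ω, objective ν F (X.x t ω) ∂P - objective ν F y with he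
  set r : ℕ → ℝ := fun t => ∫ ω, ‖X.x t ω - y‖ ^ 2 ∂P with hr
  have hr0 : ∀ t, 0 ≤ r t := fun t => integral_nonneg fun _ => sq_nonneg _
  have hstep : ∀ t < T, r (t + 1) ≤ r t
      - 2 * (8 / (s * (a + (t : ℝ)))) * (e t + s / 4 * r t - B ^ 2 / s)
      + (8 / (s * (a + (t : ℝ)))) ^ 2 * (D * V) := by
    intro t ht
    have hat : 0 < a + (t : ℝ) := by positivity
    have h := hS.stronglyConvex_step hL hs hconv hμr2 ht (hα t ht) (by rw [hη t ht]; positivity)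
      hy hBr hBc
    rwa [hη t ht] at h
  set S := ∑ t ∈ Finset.range T, (a + (t : ℝ)) ^ 2 with hSdef
  have hTS : (T : ℝ) ≤ S := le_sum_add_sq ha.le T
  have hS0 : 0 < S := by linarith
  have hsum := sum_sq_mul_le_of_step hs ha hS.T_pos (by positivity) hr0 hstep
  have hR0 : r 0 ≤ R ^ 2 := hS.integral_norm_sub_sq_le (Nat.zero_le _) hy
  have h1S : 1 / S ≤ 2 * (1 / (T : ℝ) * D) := by
    have h1 : 1 / S ≤ 1 / (T : ℝ) := one_div_le_one_div_of_le (by positivity) hTS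
    have h2 : 0 < 1 / (T : ℝ) := by positivity
    nlinarith
  rw [← hyopt]
  exact (hS.integral_objective_weightedAverage_sub_le hL ha _).trans
    (stronglyConvex_rate_arith hs ha.le (by positivity) hS0 (hr0 0) hR0 hB2 h1S hsum)

end

end ZOHGD

end

theorem theorem2 :
    -- Convex case: constants `C` depend only on `L, R, G, σ`, on the constant `M` in
    -- `μ_c = O(…)` and on the constant `κ` in the step size.
    (∀ L R G σ M κ : ℝ, 0 ≤ L → 0 ≤ σ → 0 < κ → ∃ C : ℝ,
      ∀ (d T : ℕ) (c : ℝ) (prm : Params)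
        (Ξ : Type*) [MeasurableSpace Ξ] (ν : Measure Ξ) [IsProbabilityMeasure ν]
        (F : Vec d → Ξ → ℝ) (K : Set (Vec d))
        (Ω : Type*) [MeasurableSpace Ω] (P : Measure Ω) [IsProbabilityMeasure P]
        (X : Trajectory d Ξ Ω prm),
        Setting P ν F K L R G σ c prm T X →
        prm.μc = prm.μr * √(d : ℝ) / 2 →
        prm.μc ≤ M * √(1 / ((d : ℝ) * T) * effDim d prm.nr c) →
        (∀ t < T, prm.η t = κ / √((T : ℝ) * effDim d prm.nr c)) →
        (∀ t < T, prm.α t = 1 / (1 + c * dnr d prm.nr)) →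
        (∀ t ∈ Finset.Icc 1 T, Integrable (fun ω => objective ν F (X.x t ω)) P) ∧
        ((1 / (T : ℝ)) * ∑ t ∈ Finset.Icc 1 T, (∫ ω, objective ν F (X.x t ω) ∂P))
            - optValue (objective ν F) K
          ≤ C * √(1 / (T : ℝ) * effDim d prm.nr c)) ∧
    -- Strongly convex case: `s` is the parameter of strong convexity, and `C` depends only on
    -- `L, R, G, σ, s, a` and on the constant `M` in `μ_c = O(…)`.
    (∀ L R G σ M s a : ℝ, 0 ≤ L → 0 ≤ σ → 0 < s → 1 < a → ∃ C : ℝ,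
      ∀ (d T : ℕ) (c : ℝ) (prm : Params)
        (Ξ : Type*) [MeasurableSpace Ξ] (ν : Measure Ξ) [IsProbabilityMeasure ν]
        (F : Vec d → Ξ → ℝ) (K : Set (Vec d))
        (Ω : Type*) [MeasurableSpace Ω] (P : Measure Ω) [IsProbabilityMeasure P]
        (X : Trajectory d Ξ Ω prm),
        Setting P ν F K L R G σ c prm T X →
        StronglyConvexOnDomain (objective ν F) K s →
        prm.μr = prm.μc * √((d : ℝ) * L / s) →
        L * prm.μr * (d : ℝ) ≤ σ →
        prm.μc ≤ M * √(1 / ((d : ℝ) * T) * effDim d prm.nr c) →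
        (∀ t < T, prm.η t = 8 / (s * (a + (t : ℝ)))) →
        (∀ t < T, prm.α t = 1 / (1 + c * dnr d prm.nr)) →
        Integrable (fun ω => objective ν F (weightedAverage X a T ω)) P ∧
        (∫ ω, objective ν F (weightedAverage X a T ω) ∂P) - optValue (objective ν F) K
          ≤ C * (1 / (T : ℝ) * effDim d prm.nr c)) := by
  refine ⟨fun L R G σ M κ hL hσ hκ => ⟨_, fun d T c prm Ξ _ ν _ F K Ω _ P _ X hS hμ hM hη hα =>
    ⟨fun t ht => hS.integrable_objective hL (Finset.mem_Icc.1 ht).2,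
      hS.convex_rate hL hκ hμ hM hη hα⟩⟩,
    fun L R G σ M s a hL hσ hs ha => ⟨_, fun d T c prm Ξ _ ν _ F K Ω _ P _ X hS hconv hμ hμσ hM
      hη hα => ⟨hS.integrable_objective_weightedAverage hL ha,
        hS.stronglyConvex_rate hL hs ha hconv hμ hμσ hM hη hα⟩⟩⟩
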